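/- Let $\mathbb K\in\{\mathbb R,\mathbb C\}$, $a<b$, and let $P_0,P_1\in\mathbb R^{n\times n}$, $W_B\in\mathbb R^{n\times 2n}$ and $H:[a,b]\to\mathbb R^{n\times n}$ satisfy: (a) $W_B$ has rank $n$ and $W_B\Sigma W_B^{*}\ge 0$, where $\Sigma=\begin{pmatrix}0&1_n\\1_n&0\end{pmatrix}$; (b) $H\in C^1([a,b],\mathbb R^{n\times n})$, every $H(\zeta)$ is symmetric, and there are $m,M>0$ with $m1_n\le H(\zeta)\le M1_n$ for all $\zeta\in[a,b]$; (c) $P_1$ is symmetric and invertible, and $P_0^{\top}=-P_0$. Let $\mathcal X=L^2([a,b],\mathbb K^n)$ with inner product $\langle f,g\rangle_{\mathcal X}=\frac12\int_a^b g(\zeta)^*H(\zeta)f(\zeta)\,d\zeta$ and norm $\|\cdot\|_{\mathcal X}$. Let $A x=\left(P_1\frac{\partial}{\partial\zeta}+P_0\right)(Hx)$ with domain $$D(A)=\left\{x\in L^2([a,b],\mathbb K^n)\ :\ Hx\in H^1([a,b],\mathbb K^n),\ W_B\begin{pmatrix}e_\partial\\ f_\partial\end{pmatrix}=0\right\},\qquad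 \begin{pmatrix}e_\partial\\ f_\partial\end{pmatrix}=\frac1{\sqrt2}\begin{pmatrix}1_n&1_n\\P_1&-P_1\end{pmatrix}\begin{pmatrix}(Hx)(b)\\(Hx)(a)\end{pmatrix},$$ where point values are those of the continuous representative. Let $(T(t))_{t\ge0}$ be the (contraction) $C_0$-semigroup on $\mathcal X$ generated by $A$, and let $\gamma>0$ satisfy $\gamma H(\zeta)\ge\pm P_1^{-1}$ for all $\zeta\in[a,b]$. For $x_0\in D(A)$ write $x(t)=T(t)x_0$ and $(x^*Hx)(t,\zeta)=x(t,\zeta)^*H(\zeta)x(t,\zeta)$. Then the following assertions are equivalent: (i) The semigroup is exponentially stable: there are $C,\omega>0$ such that $\|T(t)\|\le Ce^{-\omega t}$ for all $t\ge0$, in the operator norm induced by $\|\cdot\|_{\mathcal X}$. (ii) There exist $0<\sigma<\tau<T_1$ with $\tau-\sigma>2\gamma(b-a)$ and $k>0$ such that for all $x_0\in D(A)$ $$\|x(T_1)\|_{\mathcal X}^2-\|x_0\|_{\mathcal X}^2\le-k\int_\sigma^\tau(x^*Hx)(t,b)\,dt .$$ (iii) There exist $0<\sigma<\tau<T_1$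 with $\tau-\sigma>2\gamma(b-a)$ and $k>0$ such that for all $x_0\in D(A)$ $$\|x(T_1)\|_{\mathcal X}^2-\|x_0\|_{\mathcal X}^2\le-k\int_\sigma^\tau(x^*Hx)(t,a)\,dt .$$ -/

import Mathlib

open MeasureTheory Set Filter Topology
open scoped ContDiff Matrix

noncomputable section

namespace PortHamiltonian

/-- The coefficient data of a port-Hamiltonian system on the interval `[a, b]` with state
dimension `n`. The columns of `WB` are indexed by a sum type: the left summand refers to the boundary
effort, the right summand to the boundary flow. -/
structure PHSystem (n : ℕ) where
  a : ℝ
  b : ℝ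
  P₁ : Matrix (Fin n) (Fin n) ℝ
  P₀ : Matrix (Fin n) (Fin n) ℝ
  WB : Matrix (Fin n) (Fin n ⊕ Fin n) ℝ
  H : ℝ → Matrix (Fin n) (Fin n) ℝ

namespace PHSystem

/-- The standing assumptions on the coefficients. Matrix inequalities are in the Loewner order. -/
structure StandingAssumptions {n : ℕ} (S : PHSystem n) : Prop where
  lt : S.a < S.b
  rank_WB : S.WB.rank = n
  WB_nonneg : (S.WB *
    (Matrix.fromBlocks 0 1 1 0 : Matrix (Fin n ⊕ Fin n) (Fin n ⊕ Fin n) ℝ) * S.WBᵀ).PosSemidef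
  H_contDiff : ∀ i j, ContDiffOn ℝ 1 (fun ζ => S.H ζ i j) (Icc S.a S.b)
  H_symm : ∀ ζ ∈ Icc S.a S.b, (S.H ζ).IsSymm
  H_bounds : ∃ m M : ℝ, 0 < m ∧ 0 < M ∧ ∀ ζ ∈ Icc S.a S.b,
    (S.H ζ - m • (1 : Matrix (Fin n) (Fin n) ℝ)).PosSemidef ∧
      (M • (1 : Matrix (Fin n) (Fin n) ℝ) - S.H ζ).PosSemidef
  P₁_symm : S.P₁.IsSymm
  P₁_invertible : IsUnit S.P₁
  P₀_skew : S.P₀ᵀ = -S.P₀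

end PHSystem

/-- A real matrix acting on a vector with entries in `𝕜 = ℝ` or `ℂ`. -/
def realMulVec {𝕜 : Type*} [RCLike 𝕜] {ι κ : Type*} [Fintype κ]
    (M : Matrix ι κ ℝ) (v : κ → 𝕜) : ι → 𝕜 :=
  (M.map (algebraMap ℝ 𝕜)) *ᵥ v

/-- A real square matrix acting on the Euclidean space `𝕜ⁿ`. -/
def realAct {𝕜 : Type*} [RCLike 𝕜] {n : ℕ} (M : Matrix (Fin n) (Fin n) ℝ)
    (v : EuclideanSpace 𝕜 (Fin n)) : EuclideanSpace 𝕜 (Fin n) :=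
  WithLp.toLp 2 (realMulVec M v.ofLp)

/-- The space `L²([a, b], 𝕜ⁿ)`. -/
abbrev L2 (𝕜 : Type*) [RCLike 𝕜] (n : ℕ) (a b : ℝ) : Type _ :=
  Lp (EuclideanSpace 𝕜 (Fin n)) 2 (volume.restrict (Icc a b))

section Sobolev

variable {E : Type*} [NormedAddCommGroup E]

/-- `v` is the weak derivative of `u` on `(a, b)`, tested against smooth functions with compact
support in `(a, b)`. -/
def HasWeakDeriv [NormedSpace ℝ E] (a b : ℝ) (u v : ℝ → E) : Prop :=
  ∀ φ : ℝ → ℝ, ContDiff ℝ ∞ φ → HasCompactSupport φ → tsupport φ ⊆ Ioo a b →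
    ∫ ζ in Icc a b, deriv φ ζ • u ζ = -∫ ζ in Icc a b, φ ζ • v ζ

/-- `u ∈ H¹([a, b], E)` with weak derivative `v ∈ L²([a, b], E)`. -/
structure IsH1With [NormedSpace ℝ E] (a b : ℝ) (u v : ℝ → E) : Prop where
  memLp : MemLp u 2 (volume.restrict (Icc a b))
  memLp_deriv : MemLp v 2 (volume.restrict (Icc a b))
  hasWeakDeriv : HasWeakDeriv a b u v

open Classical in
/-- The continuous representative on `[a, b]` of the almost-everywhere class of `u`, which gives a
meaning to point values of `H¹` functions (junk value `0` if there is none). -/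
def contRep (a b : ℝ) (u : ℝ → E) : ℝ → E :=
  if h : ∃ w : ℝ → E, ContinuousOn w (Icc a b) ∧ u =ᵐ[volume.restrict (Icc a b)] w
  then h.choose else 0

/-- The point values of the continuous representative on `[a, b]` do not depend on any choice. -/
theorem contRep_eqOn {a b : ℝ} (hab : a < b) {u w : ℝ → E} (hw : ContinuousOn w (Icc a b))
    (huw : u =ᵐ[volume.restrict (Icc a b)] w) : EqOn (contRep a b u) w (Icc a b) := by
  have h : ∃ w : ℝ → E, ContinuousOn w (Icc a b) ∧ u =ᵐ[volume.restrict (Icc a b)] w :=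
    ⟨w, hw, huw⟩
  have hs := h.choose_spec
  rw [contRep, dif_pos h]
  exact Measure.eqOn_Icc_of_ae_eq volume hab.ne (hs.2.symm.trans huw) hs.1 hw

end Sobolev

/-- A strongly continuous one-parameter semigroup of bounded operators on `X`
(the values at negative times are irrelevant). -/
structure IsC0Semigroup {𝕜 X : Type*} [RCLike 𝕜] [NormedAddCommGroup X] [NormedSpace 𝕜 X]
    (T : ℝ → X →L[𝕜] X) : Prop where
  zero : T 0 = ContinuousLinearMap.id 𝕜 X
  add : ∀ s t : ℝ, 0 ≤ s → 0 ≤ t → T (s + t) = (T s).comp (T t)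
  continuousOn : ∀ x : X, ContinuousOn (fun t => T t x) (Ici 0)

/-- The (infinitesimal) generator of `T` is the operator with graph `A`: one has `x ∈ D(A)` and
`A x = y` exactly when the right derivative of `t ↦ T t x` at `0` exists and equals `y`. -/
def IsGenerator {𝕜 X : Type*} [RCLike 𝕜] [NormedAddCommGroup X] [NormedSpace 𝕜 X]
    (T : ℝ → X →L[𝕜] X) (A : X → X → Prop) : Prop :=
  ∀ x y : X, A x y ↔ Tendsto (fun t : ℝ => ((t⁻¹ : ℝ) : 𝕜) • (T t x - x)) (𝓝[>] 0) (𝓝 y)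

namespace PHSystem

variable {𝕜 : Type*} [RCLike 𝕜] {n : ℕ} (S : PHSystem n)

/-- The function `ζ ↦ H(ζ) x(ζ)`. -/
def mulH (x : ℝ → EuclideanSpace 𝕜 (Fin n)) : ℝ → EuclideanSpace 𝕜 (Fin n) :=
  fun ζ => realAct (S.H ζ) (x ζ)

/-- The vector `(e_∂, f_∂)` of boundary effort and boundary flow,
`2^{-1/2} [[1, 1], [P₁, -P₁]] ((Hx)(b), (Hx)(a))`. -/
def boundaryPort (x : ℝ → EuclideanSpace 𝕜 (Fin n)) : Fin n ⊕ Fin n → 𝕜 :=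
  realMulVec ((1 / √2 : ℝ) • Matrix.fromBlocks 1 1 S.P₁ (-S.P₁))
    (Sum.elim (contRep S.a S.b (S.mulH x) S.b).ofLp (contRep S.a S.b (S.mulH x) S.a).ofLp)

/-- The domain `D(A)`: all `x ∈ L²` with `H x ∈ H¹` and `W_B (e_∂, f_∂) = 0`. -/
def domain (𝕜 : Type*) [RCLike 𝕜] {n : ℕ} (S : PHSystem n) : Set (L2 𝕜 n S.a S.b) :=
  {x | (∃ v, IsH1With S.a S.b (S.mulH x) v) ∧ realMulVec S.WB (S.boundaryPort x) = 0}

/-- The graph of `A = (P₁ ∂/∂ζ + P₀) H` with domain `D(A)`. -/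
def opGraph (𝕜 : Type*) [RCLike 𝕜] {n : ℕ} (S : PHSystem n) (x y : L2 𝕜 n S.a S.b) : Prop :=
  x ∈ S.domain 𝕜 ∧ ∃ v, IsH1With S.a S.b (S.mulH x) v ∧
    y =ᵐ[volume.restrict (Icc S.a S.b)]
      fun ζ => realAct S.P₁ (v ζ) + realAct S.P₀ (S.mulH x ζ)

/-- The inner product `⟨f, g⟩_𝒳 = ½ ∫ g* H f` of the energy space. -/
def energyInner (f g : L2 𝕜 n S.a S.b) : 𝕜 :=
  (1 / 2 : 𝕜) * ∫ ζ in Icc S.a S.b, inner 𝕜 (g ζ) (S.mulH f ζ)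

/-- The norm `‖f‖_𝒳` of the energy space. -/
def energyNorm (f : L2 𝕜 n S.a S.b) : ℝ :=
  √(RCLike.re (S.energyInner f f))

/-- The pointwise energy density `(x* H x)(δ)`, through the continuous representative of `x`. -/
def energyDensityAt (x : L2 𝕜 n S.a S.b) (δ : ℝ) : ℝ :=
  RCLike.re (inner 𝕜 (contRep S.a S.b x δ) (realAct (S.H δ) (contRep S.a S.b x δ)))

/-- Exponential stability, in the operator norm induced by `‖·‖_𝒳`. -/
def ExponentiallyStable (T : ℝ → L2 𝕜 n S.a S.b →L[𝕜] L2 𝕜 n S.a S.b) : Prop :=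
  ∃ C r : ℝ, 0 < C ∧ 0 < r ∧ ∀ t : ℝ, 0 ≤ t → ∀ x : L2 𝕜 n S.a S.b,
    S.energyNorm (T t x) ≤ C * Real.exp (-r * t) * S.energyNorm x

/-- The integrated dissipation condition at the point `δ`. -/
def DissipationAt (γ : ℝ) (T : ℝ → L2 𝕜 n S.a S.b →L[𝕜] L2 𝕜 n S.a S.b) (δ : ℝ) : Prop :=
  ∃ σ τ T₁ k : ℝ, 0 < σ ∧ σ < τ ∧ τ < T₁ ∧ 2 * γ * (S.b - S.a) < τ - σ ∧ 0 < k ∧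
    ∀ x₀ ∈ S.domain 𝕜, S.energyNorm (T T₁ x₀) ^ 2 - S.energyNorm x₀ ^ 2 ≤
      -k * ∫ t in σ..τ, S.energyDensityAt (T t x₀) δ

end PHSystem

end PortHamiltonian

end

/-!
The energy `½ ∫ x* H x` does not increase along the semigroup: the boundary condition forces the
boundary flux `½ [(H x)* P₁ (H x)]_a^b` to be nonpositive
(`dotProduct_exchange_nonpos_of_mulVec_eq_zero`, `PHSystem.formL2_H_nonpos`). Hence exponential
stability amounts to a strict decrease of the energy by a fixed factor at one time
(`PHSystem.exponentiallyStable_of_strict_contraction`), and the theorem compares this decrease with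
the energy density observed at an endpoint.

Both comparisons come from one multiplier identity (`PHSystem.boundary_identity`). For `x ∈ D(A)`
and a `C¹` weight `β`, integrating `(β x* H x)'` over `[a, b]` and eliminating `(H x)'` by means of
`A x` gives
`[β x* H x]_a^b = 2 Re ∫ β x* P₁⁻¹ A x + ∫ x* (β' H + β R) x`
with a bounded matrix function `R`. Along an orbit, the first integral on the right is the time
derivative of `∫ β x* P₁⁻¹ x`, which is bounded by `γ ∫ |β| x* H x`.

* A weight that is linear in `ζ` and vanishes at the other endpoint bounds the time integral of the
  energy density at the endpoint by the initial energy (`PHSystem.IsEndpoint.exists_trace_bound`).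
  If the semigroup decays exponentially, the energy lost up to a late time is a fixed part of the
  initial energy, so it dominates this integral.
* Conversely, a weight `e^{μ ρ(ζ)} / cosh (lam (t - c))`, with `ρ` the negative distance to the
  endpoint and `μ = κ + lam γ + 1`, where `κ` bounds `R` relative to `H`, absorbs the time derivative
  of the weight and the lower-order term. Over the window `[c - L, c + L]`, this bounds the energy
  at the final time by the observation plus a defect from the two ends of the window
  (`PHSystem.IsEndpoint.exists_observability`). The relative size of the defect is of the order
  `e^{-lam (L - ε - γ (b - a))}`, which tends to `0` as `lam → ∞` because `L > γ (b - a)`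
  (`PHSystem.exists_defect_lt`). The dissipation condition then yields a strict contraction.

Orbits starting in `D(A)` are only differentiated from the right; estimates pass to all of `L²` by
density of `D(A)`. The identities on `[a, b]` rest on the absolutely continuous representative of an
`H¹` function, which comes from the du Bois-Reymond lemma
(`ae_eq_const_of_integral_deriv_mul_eq_zero`).
-/

namespace PortHamiltonian

/-! ### Real matrices acting on `𝕜ⁿ` -/

section LinearAlgebra

variable {𝕜 : Type*} [RCLike 𝕜] {n : ℕ} {ι κ : Type*} [Fintype κ]

theorem re_realMulVec (M : Matrix ι κ ℝ) (v : κ → 𝕜) :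
    (fun i => RCLike.re (realMulVec M v i)) = M *ᵥ fun j => RCLike.re (v j) := by
  ext i
  simp [realMulVec, Matrix.mulVec, dotProduct, map_sum]

theorem im_realMulVec (M : Matrix ι κ ℝ) (v : κ → 𝕜) :
    (fun i => RCLike.im (realMulVec M v i)) = M *ᵥ fun j => RCLike.im (v j) := by
  ext i
  simp [realMulVec, Matrix.mulVec, dotProduct, map_sum]

/-- The real part of the sesquilinear form `u* K v` of a real matrix `K` on `𝕜ⁿ`. -/
noncomputable def formRe (K : Matrix (Fin n) (Fin n) ℝ) (u v : EuclideanSpace 𝕜 (Fin n)) : ℝ :=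
  RCLike.re (inner 𝕜 u (realAct K v))

/-- A real matrix sees the real and the imaginary part of a vector separately. -/
theorem formRe_eq_dotProduct (K : Matrix (Fin n) (Fin n) ℝ) (u v : EuclideanSpace 𝕜 (Fin n)) :
    formRe K u v = (fun i => RCLike.re (u i)) ⬝ᵥ K *ᵥ (fun i => RCLike.re (v i)) +
      (fun i => RCLike.im (u i)) ⬝ᵥ K *ᵥ (fun i => RCLike.im (v i)) := by
  rw [← re_realMulVec, ← im_realMulVec]
  simp only [formRe, PiLp.inner_apply, map_sum, dotProduct, ← Finset.sum_add_distrib]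
  refine Finset.sum_congr rfl fun i _ => ?_
  simp [realAct, RCLike.inner_apply]
  ring

theorem formRe_eq_sum (K : Matrix (Fin n) (Fin n) ℝ) (u v : EuclideanSpace 𝕜 (Fin n)) :
    formRe K u v = ∑ i, ∑ j, K i j *
      (RCLike.re (u i) * RCLike.re (v j) + RCLike.im (u i) * RCLike.im (v j)) := by
  rw [formRe_eq_dotProduct]
  simp only [Matrix.mulVec, dotProduct, Finset.mul_sum, ← Finset.sum_add_distrib]
  refine Finset.sum_congr rfl fun i _ => Finset.sum_congr rfl fun j _ => ?_
  ring

theorem realAct_mul (A B : Matrix (Fin n) (Fin n) ℝ) (v : EuclideanSpace 𝕜 (Fin n)) :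
    realAct (A * B) v = realAct A (realAct B v) := by
  simp [realAct, realMulVec, Matrix.map_mul]

theorem realAct_one (v : EuclideanSpace 𝕜 (Fin n)) : realAct 1 v = v := by
  simp [realAct, realMulVec]

theorem realAct_add_right (A : Matrix (Fin n) (Fin n) ℝ) (u v : EuclideanSpace 𝕜 (Fin n)) :
    realAct A (u + v) = realAct A u + realAct A v := by
  simp [realAct, realMulVec, Matrix.mulVec_add]

theorem realAct_sub_right (A : Matrix (Fin n) (Fin n) ℝ) (u v : EuclideanSpace 𝕜 (Fin n)) :
    realAct A (u - v) = realAct A u - realAct A v := by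
  simp [realAct, realMulVec, Matrix.mulVec_sub]

theorem realAct_smul_right (A : Matrix (Fin n) (Fin n) ℝ) (c : 𝕜)
    (v : EuclideanSpace 𝕜 (Fin n)) : realAct A (c • v) = c • realAct A v := by
  simp [realAct, realMulVec, Matrix.mulVec_smul]

theorem realAct_apply (A : Matrix (Fin n) (Fin n) ℝ) (v : EuclideanSpace 𝕜 (Fin n)) (i : Fin n) :
    realAct A v i = ∑ j, (A i j : 𝕜) * v j := by
  simp [realAct, realMulVec, Matrix.mulVec, dotProduct]

theorem realAct_inv_realAct {A : Matrix (Fin n) (Fin n) ℝ} (hA : IsUnit A)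
    (v : EuclideanSpace 𝕜 (Fin n)) : realAct A⁻¹ (realAct A v) = v := by
  rw [← realAct_mul, Matrix.nonsing_inv_mul _ ((Matrix.isUnit_iff_isUnit_det A).1 hA), realAct_one]

theorem norm_realAct_le (A : Matrix (Fin n) (Fin n) ℝ) (v : EuclideanSpace 𝕜 (Fin n)) :
    ‖realAct A v‖ ≤ (∑ i, ∑ j, |A i j|) * ‖v‖ := by
  have h : ‖realAct A v‖ ≤ ∑ i, ‖realAct A v i‖ := by
    rw [EuclideanSpace.norm_eq]
    refine Real.sqrt_le_iff.2 ⟨Finset.sum_nonneg fun _ _ => norm_nonneg _, ?_⟩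
    exact Finset.sum_sq_le_sq_sum_of_nonneg fun _ _ => norm_nonneg _
  refine h.trans ?_
  rw [Finset.sum_mul]
  refine Finset.sum_le_sum fun i _ => ?_
  rw [realAct_apply, Finset.sum_mul]
  refine (norm_sum_le _ _).trans (Finset.sum_le_sum fun j _ => ?_)
  rw [norm_mul, RCLike.norm_ofReal]
  exact mul_le_mul_of_nonneg_left (PiLp.norm_apply_le v j) (abs_nonneg _)

theorem formRe_add_matrix (A B : Matrix (Fin n) (Fin n) ℝ) (u v : EuclideanSpace 𝕜 (Fin n)) :
    formRe (A + B) u v = formRe A u v + formRe B u v := by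
  simp only [formRe_eq_dotProduct, Matrix.add_mulVec, dotProduct_add]; ring

theorem formRe_sub_matrix (A B : Matrix (Fin n) (Fin n) ℝ) (u v : EuclideanSpace 𝕜 (Fin n)) :
    formRe (A - B) u v = formRe A u v - formRe B u v := by
  simp only [formRe_eq_dotProduct, Matrix.sub_mulVec, dotProduct_sub]; ring

theorem formRe_smul_matrix (c : ℝ) (A : Matrix (Fin n) (Fin n) ℝ)
    (u v : EuclideanSpace 𝕜 (Fin n)) : formRe (c • A) u v = c * formRe A u v := by
  simp only [formRe_eq_dotProduct, Matrix.smul_mulVec, dotProduct_smul, smul_eq_mul]; ring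

theorem formRe_one (v : EuclideanSpace 𝕜 (Fin n)) : formRe 1 v v = ‖v‖ ^ 2 := by
  rw [formRe, realAct_one, inner_self_eq_norm_sq]

theorem formRe_sub_right (A : Matrix (Fin n) (Fin n) ℝ) (u v w : EuclideanSpace 𝕜 (Fin n)) :
    formRe A u (v - w) = formRe A u v - formRe A u w := by
  simp only [formRe, realAct_sub_right, inner_sub_right, map_sub]

theorem formRe_realAct_right (A B : Matrix (Fin n) (Fin n) ℝ) (u v : EuclideanSpace 𝕜 (Fin n)) :
    formRe A u (realAct B v) = formRe (A * B) u v := by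
  rw [formRe, formRe, realAct_mul]

theorem formRe_transpose (A : Matrix (Fin n) (Fin n) ℝ) (u v : EuclideanSpace 𝕜 (Fin n)) :
    formRe Aᵀ u v = formRe A v u := by
  rw [formRe_eq_sum, formRe_eq_sum, Finset.sum_comm]
  refine Finset.sum_congr rfl fun i _ => Finset.sum_congr rfl fun j _ => ?_
  rw [Matrix.transpose_apply]
  ring

theorem formRe_realAct_left (A B : Matrix (Fin n) (Fin n) ℝ) (u v : EuclideanSpace 𝕜 (Fin n)) :
    formRe A (realAct B u) v = formRe (Bᵀ * A) u v := by
  rw [← formRe_transpose, formRe_realAct_right, ← formRe_transpose, Matrix.transpose_mul,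
    Matrix.transpose_transpose]

theorem formRe_comm {A : Matrix (Fin n) (Fin n) ℝ} (hA : A.IsSymm)
    (u v : EuclideanSpace 𝕜 (Fin n)) : formRe A u v = formRe A v u := by
  conv_lhs => rw [← hA.eq]
  exact formRe_transpose A u v

theorem formRe_self_of_skew {A : Matrix (Fin n) (Fin n) ℝ} (hA : Aᵀ = -A)
    (u : EuclideanSpace 𝕜 (Fin n)) : formRe A u u = 0 := by
  have h := formRe_transpose A u u
  rw [hA, ← neg_one_smul ℝ A, formRe_smul_matrix] at h
  linarith

theorem formRe_self_nonneg {A : Matrix (Fin n) (Fin n) ℝ} (hA : A.PosSemidef)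
    (v : EuclideanSpace 𝕜 (Fin n)) : 0 ≤ formRe A v v := by
  rw [formRe_eq_dotProduct]
  exact add_nonneg (by simpa using hA.dotProduct_mulVec_nonneg (fun i => RCLike.re (v i)))
    (by simpa using hA.dotProduct_mulVec_nonneg (fun i => RCLike.im (v i)))

theorem abs_formRe_le (A : Matrix (Fin n) (Fin n) ℝ) (u v : EuclideanSpace 𝕜 (Fin n)) :
    |formRe A u v| ≤ (∑ i, ∑ j, |A i j|) * (‖u‖ * ‖v‖) := by
  calc |formRe A u v| ≤ ‖inner 𝕜 u (realAct A v)‖ := RCLike.abs_re_le_norm _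
    _ ≤ ‖u‖ * ‖realAct A v‖ := norm_inner_le_norm _ _
    _ ≤ ‖u‖ * ((∑ i, ∑ j, |A i j|) * ‖v‖) := by gcongr; exact norm_realAct_le A v
    _ = _ := by ring

/-- If `W` has full row rank and `W Σ Wᵀ ≥ 0` for the exchange matrix `Σ`, then the form of `Σ` is
nonpositive on the kernel of `W`. Indeed, if `z ∈ ker W` had `zᵀ Σ z > 0`, then `Σ` would be
nonnegative on the `n + 1`-dimensional space spanned by `z` and the range of `Σ Wᵀ`, which is too
large to avoid the `n`-dimensional space of all `(u, -u)`, where `Σ` is negative definite. -/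
theorem dotProduct_exchange_nonpos_of_mulVec_eq_zero (W : Matrix (Fin n) (Fin n ⊕ Fin n) ℝ)
    (hrank : W.rank = n)
    (hW : (W * (Matrix.fromBlocks 0 1 1 0 : Matrix (Fin n ⊕ Fin n) (Fin n ⊕ Fin n) ℝ) *
      Wᵀ).PosSemidef)
    (z : Fin n ⊕ Fin n → ℝ) (hz : W *ᵥ z = 0) :
    z ⬝ᵥ (Matrix.fromBlocks 0 1 1 0 : Matrix (Fin n ⊕ Fin n) (Fin n ⊕ Fin n) ℝ) *ᵥ z ≤ 0 := by
  set J : Matrix (Fin n ⊕ Fin n) (Fin n ⊕ Fin n) ℝ := Matrix.fromBlocks 0 1 1 0 with hJ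
  have hJJ : J * J = 1 := by
    simp [hJ, Matrix.fromBlocks_multiply]
  have hJt : Jᵀ = J := by simp [hJ, Matrix.fromBlocks_transpose]
  by_contra! hpos
  have hinj : ∀ y : Fin n → ℝ, Wᵀ *ᵥ y = 0 → y = 0 := by
    have h1 : Module.finrank ℝ (LinearMap.range Wᵀ.mulVecLin) = n := by
      have := Matrix.rank_transpose W
      rw [hrank] at this
      exact this
    have h2 := LinearMap.finrank_range_add_finrank_ker Wᵀ.mulVecLin
    rw [h1, Module.finrank_fin_fun] at h2
    have h3 : LinearMap.ker Wᵀ.mulVecLin = ⊥ := Submodule.finrank_eq_zero.1 (by omega)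
    intro y hy
    exact (LinearMap.ker_eq_bot'.1 h3) y hy
  -- the sum of the two halves of `c z + Σ Wᵀ y`, as a linear function of `(c, y)`
  let F : (ℝ × (Fin n → ℝ)) →ₗ[ℝ] (Fin n → ℝ) :=
    { toFun := fun p i => (p.1 • z + J *ᵥ (Wᵀ *ᵥ p.2)) (Sum.inl i) +
        (p.1 • z + J *ᵥ (Wᵀ *ᵥ p.2)) (Sum.inr i)
      map_add' := by
        intro p q; ext i
        simp only [Prod.fst_add, Prod.snd_add, Matrix.mulVec_add, Pi.add_apply, add_smul]; ring
      map_smul' := by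
        intro r p; ext i
        simp only [Prod.smul_fst, Prod.smul_snd, Matrix.mulVec_smul, Pi.add_apply, Pi.smul_apply,
          smul_eq_mul, RingHom.id_apply]
        ring }
  have hker : LinearMap.ker F ≠ ⊥ := by
    apply LinearMap.ker_ne_bot_of_finrank_lt
    simp [Module.finrank_prod]
  obtain ⟨⟨c, y⟩, hcy, hne⟩ := (Submodule.ne_bot_iff _).1 hker
  set v := c • z + J *ᵥ (Wᵀ *ᵥ y) with hv
  have hvi : ∀ i, v (Sum.inr i) = -v (Sum.inl i) := by
    intro i
    have := congrFun (LinearMap.mem_ker.1 hcy) i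
    change v (Sum.inl i) + v (Sum.inr i) = 0 at this
    linarith
  have hneg : v ⬝ᵥ J *ᵥ v = -2 * ∑ i, v (Sum.inl i) ^ 2 := by
    have hJv : J *ᵥ v = Sum.elim (v ∘ Sum.inr) (v ∘ Sum.inl) := by
      simp [hJ, Matrix.fromBlocks_mulVec]
    rw [hJv, dotProduct, Fintype.sum_sum_type, Finset.mul_sum, ← Finset.sum_add_distrib]
    refine Finset.sum_congr rfl fun i _ => ?_
    simp [hvi i]; ring
  have hJv : J *ᵥ v = c • (J *ᵥ z) + Wᵀ *ᵥ y := by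
    rw [hv, Matrix.mulVec_add, Matrix.mulVec_smul, Matrix.mulVec_mulVec, hJJ, Matrix.one_mulVec]
  have hzW : z ⬝ᵥ Wᵀ *ᵥ y = 0 := by
    rw [Matrix.dotProduct_mulVec, Matrix.vecMul_transpose, hz, zero_dotProduct]
  have hWz : (J *ᵥ (Wᵀ *ᵥ y)) ⬝ᵥ (J *ᵥ z) = 0 := by
    rw [Matrix.dotProduct_mulVec, ← Matrix.mulVec_transpose, hJt, Matrix.mulVec_mulVec, hJJ,
      Matrix.one_mulVec, dotProduct_comm, hzW]
  have hyy : 0 ≤ (J *ᵥ (Wᵀ *ᵥ y)) ⬝ᵥ (Wᵀ *ᵥ y) := by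
    have := hW.dotProduct_mulVec_nonneg y
    rw [star_trivial, ← Matrix.mulVec_mulVec, ← Matrix.mulVec_mulVec, Matrix.dotProduct_mulVec,
      ← Matrix.mulVec_transpose, dotProduct_comm] at this
    exact this
  have hsum : v ⬝ᵥ J *ᵥ v = c ^ 2 * (z ⬝ᵥ J *ᵥ z) + (J *ᵥ (Wᵀ *ᵥ y)) ⬝ᵥ (Wᵀ *ᵥ y) := by
    rw [hJv, hv]
    simp only [add_dotProduct, dotProduct_add, smul_dotProduct, dotProduct_smul, hzW, hWz,
      smul_eq_mul]
    ring
  have hsq : 0 ≤ ∑ i, v (Sum.inl i) ^ 2 := Finset.sum_nonneg fun i _ => sq_nonneg _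
  have hc : c = 0 := by
    by_contra hc
    have : 0 < c ^ 2 * (z ⬝ᵥ J *ᵥ z) := by positivity
    linarith
  have hv0 : v = 0 := by
    have h0 : ∑ i, v (Sum.inl i) ^ 2 = 0 := by
      rw [hc] at hsum
      linarith
    have h1 := (Finset.sum_eq_zero_iff_of_nonneg fun i _ => sq_nonneg _).1 h0
    ext (i | i)
    · simpa using h1 i (Finset.mem_univ i)
    · simpa [hvi i] using h1 i (Finset.mem_univ i)
  have hy : y = 0 := by
    apply hinj
    rw [hv0, hc] at hJv
    simpa using hJv.symm
  exact hne (by simp [hc, hy])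

end LinearAlgebra

/-! ### Weak derivatives and absolutely continuous representatives -/

section Sobolev

theorem integral_eq_sub_of_absolutelyContinuous {a b : ℝ} {f f' : ℝ → ℝ}
    (hf : AbsolutelyContinuousOnInterval f a b)
    (hf' : ∀ᵐ x, x ∈ uIcc a b → HasDerivAt f (f' x) x) :
    ∫ x in a..b, f' x = f b - f a := by
  rw [← hf.integral_deriv_eq_sub]
  refine intervalIntegral.integral_congr_ae ?_
  filter_upwards [hf'] with x hx hxm
  exact (hx (uIoc_subset_uIcc hxm)).deriv.symm

/-- A smooth function with compact support in `(a, b)` and vanishing integral is the derivative of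
a smooth function with compact support in `(a, b)`. -/
theorem exists_primitive_compactSupport {a b : ℝ} (hab : a < b) {ψ : ℝ → ℝ}
    (hψ : ContDiff ℝ ∞ ψ) (hc : HasCompactSupport ψ) (hs : tsupport ψ ⊆ Ioo a b)
    (h0 : ∫ x, ψ x = 0) :
    ∃ φ : ℝ → ℝ, ContDiff ℝ ∞ φ ∧ HasCompactSupport φ ∧ tsupport φ ⊆ Ioo a b ∧ deriv φ = ψ := by
  obtain ⟨p, q, hap, hqb, hpq⟩ : ∃ p q, a < p ∧ q < b ∧ tsupport ψ ⊆ Icc p q := by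
    rcases (tsupport ψ).eq_empty_or_nonempty with h | h
    · exact ⟨b, a, hab, hab, by simp [h]⟩
    · obtain ⟨p, hp⟩ := IsCompact.exists_isLeast hc h
      obtain ⟨q, hq⟩ := IsCompact.exists_isGreatest hc h
      exact ⟨p, q, (hs hp.1).1, (hs hq.1).2, fun x hx => ⟨hp.2 hx, hq.2 hx⟩⟩
  have hder : deriv (fun ζ => ∫ s in a..ζ, ψ s) = ψ :=
    funext fun x => hψ.continuous.deriv_integral ψ a x
  have hzero : ∀ x, x ∉ Icc p q → ψ x = 0 := fun x hx =>
    image_eq_zero_of_notMem_tsupport fun h => hx (hpq h)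
  have hsupp : Function.support (fun ζ => ∫ s in a..ζ, ψ s) ⊆ Icc p q := by
    intro x hx
    by_contra hn
    apply hx
    rcases lt_or_ge x p with hxp | hxp
    · refine intervalIntegral.integral_zero_ae (ae_of_all _ fun s hsx => hzero s fun h => ?_)
      rcases (mem_uIoc.1 hsx) with h' | h'
      · linarith [h.1, h'.2]
      · linarith [h.1, h'.2]
    · have hxq : q < x := not_le.1 fun h => hn ⟨hxp, h⟩
      change ∫ s in a..x, ψ s = 0
      rw [intervalIntegral.integral_eq_integral_of_support_subset, h0]
      intro s hsx
      have := hpq (subset_tsupport ψ hsx)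
      exact ⟨hap.trans_le this.1, this.2.trans hxq.le⟩
  have hts : tsupport (fun ζ => ∫ s in a..ζ, ψ s) ⊆ Icc p q :=
    closure_minimal hsupp isClosed_Icc
  refine ⟨fun ζ => ∫ s in a..ζ, ψ s, ?_, HasCompactSupport.of_support_subset_isCompact
    isCompact_Icc hsupp, fun x hx => ⟨hap.trans_le (hts hx).1, (hts hx).2.trans_lt hqb⟩, hder⟩
  rw [contDiff_infty_iff_deriv, hder]
  exact ⟨fun x => (hψ.continuous.integral_hasStrictDerivAt a x).hasDerivAt.differentiableAt, hψ⟩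

/-- Du Bois-Reymond: an integrable function with vanishing weak derivative is constant. -/
theorem ae_eq_const_of_integral_deriv_mul_eq_zero {a b : ℝ} (hab : a < b) {z : ℝ → ℝ}
    (hz : IntegrableOn z (Icc a b))
    (h : ∀ φ : ℝ → ℝ, ContDiff ℝ ∞ φ → HasCompactSupport φ → tsupport φ ⊆ Ioo a b →
      ∫ ζ in Icc a b, deriv φ ζ * z ζ = 0) :
    ∃ c, z =ᵐ[volume.restrict (Icc a b)] fun _ => c := by
  -- a test function of integral `1`, by multiples of which other test functions are corrected to
  -- have integral `0`
  let bump : ContDiffBump ((a + b) / 2) := ⟨(b - a) / 6, (b - a) / 3, by linarith, by linarith⟩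
  set φ₀ : ℝ → ℝ := bump.normed volume with hφ₀
  have hφ₀s : ContDiff ℝ ∞ φ₀ := bump.contDiff_normed
  have hφ₀c : HasCompactSupport φ₀ := bump.hasCompactSupport_normed
  have hφ₀t : tsupport φ₀ ⊆ Ioo a b := by
    rw [hφ₀, bump.tsupport_normed_eq, Real.closedBall_eq_Icc]
    intro x hx
    simp only [bump, mem_Icc] at hx
    constructor <;> linarith [hx.1, hx.2]
  have hφ₀i : ∫ x, φ₀ x = 1 := bump.integral_normed
  have hint : ∀ g : ℝ → ℝ, Continuous g → IntegrableOn (fun x => g x * z x) (Icc a b) :=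
    fun g hg => hz.continuousOn_mul hg.continuousOn isCompact_Icc
  set c := ∫ ζ in Icc a b, φ₀ ζ * z ζ with hc
  refine ⟨c, ?_⟩
  have hkey : ∀ᵐ x ∂(volume.restrict (Icc a b)), x ∈ Ioo a b → z x - c = 0 := by
    refine isOpen_Ioo.ae_eq_zero_of_integral_contDiff_smul_eq_zero (f := fun x => z x - c)
      ?_ ?_
    · exact ((hz.integrable.sub (integrable_const c)).locallyIntegrable).locallyIntegrableOn _
    intro g hg hgc hgs
    have hψi : ∫ x, (g x - (∫ y, g y) * φ₀ x) = 0 := by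
      rw [integral_sub (hg.continuous.integrable_of_hasCompactSupport hgc)
        ((hφ₀s.continuous.integrable_of_hasCompactSupport hφ₀c).const_mul _),
        integral_const_mul, hφ₀i, mul_one, sub_self]
    have hψt : tsupport (fun x => g x - (∫ y, g y) * φ₀ x) ⊆ tsupport g ∪ tsupport φ₀ := by
      refine closure_minimal (fun x hx => ?_) ((isClosed_tsupport g).union (isClosed_tsupport φ₀))
      by_contra hn
      rw [mem_union, not_or] at hn
      apply hx
      simp [image_eq_zero_of_notMem_tsupport hn.1, image_eq_zero_of_notMem_tsupport hn.2]
    obtain ⟨φ, hφ, hφc, hφt, hφd⟩ := exists_primitive_compactSupport hab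
      (hg.sub (contDiff_const.mul hφ₀s))
      (IsCompact.of_isClosed_subset (hgc.isCompact.union hφ₀c.isCompact)
        (isClosed_tsupport _) hψt)
      (hψt.trans (union_subset hgs hφ₀t)) hψi
    have h1 := h φ hφ hφc hφt
    rw [hφd] at h1
    have hgg : ∫ x in Icc a b, g x = ∫ x, g x :=
      setIntegral_eq_integral_of_forall_compl_eq_zero fun x hx =>
        image_eq_zero_of_notMem_tsupport fun h' => hx (Ioo_subset_Icc_self (hgs h'))
    have h2 : ∫ x in Icc a b, (g x * z x - (∫ y, g y) * (φ₀ x * z x)) = 0 := by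
      rw [← h1]
      congr 1; ext x; ring
    rw [integral_sub (hint g hg.continuous) ((hint φ₀ hφ₀s.continuous).const_mul _),
      integral_const_mul, ← hc] at h2
    have h3 : ∫ x in Icc a b, (g x * z x - g x * c) = 0 := by
      rw [integral_sub (hint g hg.continuous)
        ((hg.continuous.continuousOn.integrableOn_Icc).mul_const c), integral_mul_const, hgg, h2]
    rw [← h3]
    congr 1; ext x; simp [mul_sub]
  have hmem : ∀ᵐ x ∂(volume.restrict (Icc a b)), x ∈ Ioo a b := by
    rw [← restrict_Ioo_eq_restrict_Icc]
    exact ae_restrict_mem measurableSet_Ioo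
  filter_upwards [hkey, hmem] with x h1 h2
  linarith [h1 h2]

/-- A real function with an integrable weak derivative `v` has a representative which is absolutely
continuous with derivative `v` almost everywhere. -/
theorem HasWeakDeriv.exists_absolutelyContinuous {a b : ℝ} (hab : a < b) {u v : ℝ → ℝ}
    (hu : IntegrableOn u (Icc a b)) (hv : IntegrableOn v (Icc a b)) (h : HasWeakDeriv a b u v) :
    ∃ w : ℝ → ℝ, u =ᵐ[volume.restrict (Icc a b)] w ∧ AbsolutelyContinuousOnInterval w a b ∧
      ∀ᵐ x, x ∈ uIcc a b → HasDerivAt w (v x) x := by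
  have hvi : IntervalIntegrable v volume a b :=
    (intervalIntegrable_iff_integrableOn_Icc_of_le hab.le).2 hv
  have hac := hvi.absolutelyContinuousOnInterval_intervalIntegral (c := a) left_mem_uIcc
  have hder := hvi.ae_hasDerivAt_integral
  set U : ℝ → ℝ := fun ζ => ∫ s in a..ζ, v s with hU
  have hUi : IntegrableOn U (Icc a b) := by
    have := hac.continuousOn
    rw [uIcc_of_le hab.le] at this
    exact this.integrableOn_Icc
  obtain ⟨c, hc⟩ := ae_eq_const_of_integral_deriv_mul_eq_zero hab (z := fun x => u x - U x)
    (hu.sub hUi) (by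
      intro φ hφ hφc hφs
      have h1 := h φ hφ hφc hφs
      have hφ0 : ∀ x, x ∉ Ioo a b → φ x = 0 := fun x hx =>
        image_eq_zero_of_notMem_tsupport fun h' => hx (hφs h')
      have hφ' : Continuous (deriv φ) := hφ.continuous_deriv (by simp)
      have hφac : AbsolutelyContinuousOnInterval φ a b :=
        (hφ.of_le (by simp)).contDiffOn.absolutelyContinuousOnInterval
      have h2 := integral_eq_sub_of_absolutelyContinuous (hφac.fun_mul hac)
        (f' := fun x => deriv φ x * U x + φ x * v x) (by
          filter_upwards [hder] with x hx hxm
          exact ((hφ.differentiable (by simp)) x).hasDerivAt.mul (hx hxm a left_mem_uIcc))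
      rw [hφ0 b (by simp), hφ0 a (by simp), intervalIntegral.integral_of_le hab.le,
        ← integral_Icc_eq_integral_Ioc] at h2
      have i1 : IntegrableOn (fun x => deriv φ x * U x) (Icc a b) :=
        hUi.continuousOn_mul hφ'.continuousOn isCompact_Icc
      have i2 : IntegrableOn (fun x => φ x * v x) (Icc a b) :=
        hv.continuousOn_mul hφ.continuous.continuousOn isCompact_Icc
      have i3 : IntegrableOn (fun x => deriv φ x * u x) (Icc a b) :=
        hu.continuousOn_mul hφ'.continuousOn isCompact_Icc
      rw [integral_add i1 i2] at h2
      simp only [smul_eq_mul] at h1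
      simp only [mul_sub]
      rw [integral_sub i3 i1, h1]
      linarith)
  refine ⟨fun x => c + U x, ?_, ?_, ?_⟩
  · filter_upwards [hc] with x hx
    linarith
  · exact (contDiff_const (c := c)).contDiffOn.absolutelyContinuousOnInterval.fun_add hac
  · filter_upwards [hder] with x hx hxm
    exact (hx hxm a left_mem_uIcc).const_add c

variable {𝕜 : Type*} [RCLike 𝕜] {n : ℕ}

/-- `w` is absolutely continuous on `[a, b]` with derivative `v` almost everywhere, in terms of the
real and imaginary parts of its components. -/
structure HasAEDeriv (a b : ℝ) (w v : ℝ → EuclideanSpace 𝕜 (Fin n)) : Prop where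
  re_ac : ∀ i, AbsolutelyContinuousOnInterval (fun x => RCLike.re (w x i)) a b
  im_ac : ∀ i, AbsolutelyContinuousOnInterval (fun x => RCLike.im (w x i)) a b
  re_deriv : ∀ i, ∀ᵐ x, x ∈ uIcc a b →
    HasDerivAt (fun x => RCLike.re (w x i)) (RCLike.re (v x i)) x
  im_deriv : ∀ i, ∀ᵐ x, x ∈ uIcc a b →
    HasDerivAt (fun x => RCLike.im (w x i)) (RCLike.im (v x i)) x

theorem HasAEDeriv.continuousOn {a b : ℝ} (hab : a ≤ b) {w v : ℝ → EuclideanSpace 𝕜 (Fin n)}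
    (h : HasAEDeriv a b w v) : ContinuousOn w (Icc a b) := by
  have key : ∀ i, ContinuousOn (fun x => w x i) (Icc a b) := by
    intro i
    have h1 := (h.re_ac i).continuousOn
    have h2 := (h.im_ac i).continuousOn
    rw [uIcc_of_le hab] at h1 h2
    have h3 : ContinuousOn (fun x => (RCLike.re (w x i) : 𝕜) + (RCLike.im (w x i) : 𝕜) * RCLike.I)
        (Icc a b) :=
      (RCLike.continuous_ofReal.comp_continuousOn h1).add
        ((RCLike.continuous_ofReal.comp_continuousOn h2).mul continuousOn_const)
    exact h3.congr fun x _ => (RCLike.re_add_im _).symm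
  exact (PiLp.continuous_toLp 2 _).comp_continuousOn (continuousOn_pi.2 key)

theorem HasWeakDeriv.comp_clm {E : Type*} [NormedAddCommGroup E] [NormedSpace ℝ E]
    [CompleteSpace E] {a b : ℝ} {u v : ℝ → E} (hu : IntegrableOn u (Icc a b))
    (hv : IntegrableOn v (Icc a b)) (h : HasWeakDeriv a b u v) (ℓ : E →L[ℝ] ℝ) :
    HasWeakDeriv a b (fun x => ℓ (u x)) (fun x => ℓ (v x)) := by
  intro φ hφ hφc hφs
  have hφ' : Continuous (deriv φ) := hφ.continuous_deriv (by simp)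
  have h1 := congrArg ℓ (h φ hφ hφc hφs)
  rw [map_neg, ← ContinuousLinearMap.integral_comp_comm, ← ContinuousLinearMap.integral_comp_comm]
    at h1
  · simpa using h1
  · exact hv.continuousOn_smul hφ.continuous.continuousOn isCompact_Icc
  · exact hu.continuousOn_smul hφ'.continuousOn isCompact_Icc

/-- The continuous linear functional `v ↦ re (v i)`. -/
noncomputable def coordRe (𝕜 : Type*) [RCLike 𝕜] {n : ℕ} (i : Fin n) :
    EuclideanSpace 𝕜 (Fin n) →L[ℝ] ℝ :=
  (RCLike.reCLM (K := 𝕜)).comp ((EuclideanSpace.proj (𝕜 := 𝕜) i).restrictScalars ℝ)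

/-- The continuous linear functional `v ↦ im (v i)`. -/
noncomputable def coordIm (𝕜 : Type*) [RCLike 𝕜] {n : ℕ} (i : Fin n) :
    EuclideanSpace 𝕜 (Fin n) →L[ℝ] ℝ :=
  (RCLike.imCLM (K := 𝕜)).comp ((EuclideanSpace.proj (𝕜 := 𝕜) i).restrictScalars ℝ)

/-- The continuous representative of an `H¹` function, with its weak derivative as derivative almost
everywhere. -/
theorem IsH1With.exists_hasAEDeriv {a b : ℝ} (hab : a < b) {u v : ℝ → EuclideanSpace 𝕜 (Fin n)}
    (h : IsH1With a b u v) :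
    ∃ w : ℝ → EuclideanSpace 𝕜 (Fin n), u =ᵐ[volume.restrict (Icc a b)] w ∧ HasAEDeriv a b w v := by
  have hu : IntegrableOn u (Icc a b) := h.memLp.integrable (by norm_num)
  have hv : IntegrableOn v (Icc a b) := h.memLp_deriv.integrable (by norm_num)
  choose f hf using fun i => HasWeakDeriv.exists_absolutelyContinuous hab
    ((coordRe 𝕜 i).integrable_comp hu) ((coordRe 𝕜 i).integrable_comp hv)
    (h.hasWeakDeriv.comp_clm hu hv (coordRe 𝕜 i))
  choose g hg using fun i => HasWeakDeriv.exists_absolutelyContinuous hab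
    ((coordIm 𝕜 i).integrable_comp hu) ((coordIm 𝕜 i).integrable_comp hv)
    (h.hasWeakDeriv.comp_clm hu hv (coordIm 𝕜 i))
  let w : ℝ → EuclideanSpace 𝕜 (Fin n) := fun x =>
    WithLp.toLp 2 fun i => (f i x : 𝕜) + (g i x : 𝕜) * RCLike.I
  have hre : ∀ i, (fun x => RCLike.re (w x i)) = f i := fun i => by ext x; simp [w]
  -- `im I` is `0` for `𝕜 = ℝ` and `1` for `𝕜 = ℂ`
  have him : ∀ i, (fun x => RCLike.im (w x i)) = fun x => RCLike.im (RCLike.I : 𝕜) * g i x :=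
    fun i => by ext x; simp [w, mul_comm]
  refine ⟨w, ?_, ?_, ?_, ?_, ?_⟩
  · filter_upwards [ae_all_iff.2 fun i => (hf i).1, ae_all_iff.2 fun i => (hg i).1] with x h1 h2
    ext i
    have h1i : RCLike.re (u x i) = f i x := h1 i
    have h2i : RCLike.im (u x i) = g i x := h2 i
    simp only [w, ← h1i, ← h2i, RCLike.re_add_im]
  · intro i; rw [hre]; exact (hf i).2.1
  · intro i; rw [him]; exact (hg i).2.1.const_mul _
  · intro i; rw [hre]; exact (hf i).2.2
  · intro i
    rw [him]
    filter_upwards [(hg i).2.2] with x hx hxm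
    have h1 := (hx hxm).const_mul (RCLike.im (RCLike.I : 𝕜))
    have h2 : RCLike.im (RCLike.I : 𝕜) * (coordIm 𝕜 i) (v x) = RCLike.im (v x i) := by
      rw [mul_comm]; exact RCLike.I_im _
    rwa [h2] at h1

end Sobolev

/-! ### Integration by parts for quadratic forms -/

section IntegrationByParts

variable {𝕜 : Type*} [RCLike 𝕜] {n : ℕ}

theorem absolutelyContinuous_sum {ι : Type*} {a b : ℝ} (s : Finset ι) {f : ι → ℝ → ℝ}
    (hf : ∀ i ∈ s, AbsolutelyContinuousOnInterval (f i) a b) :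
    AbsolutelyContinuousOnInterval (fun x => ∑ i ∈ s, f i x) a b := by
  classical
  induction s using Finset.induction_on with
  | empty =>
    simpa using (contDiff_const (c := (0 : ℝ))).contDiffOn.absolutelyContinuousOnInterval
  | insert i s hi ih =>
    simp only [Finset.sum_insert hi]
    exact (hf i (Finset.mem_insert_self i s)).fun_add
      (ih fun j hj => hf j (Finset.mem_insert_of_mem hj))

/-- The entrywise derivative of a matrix function on `[a, b]`. -/
noncomputable def matrixDeriv (a b : ℝ) (G : ℝ → Matrix (Fin n) (Fin n) ℝ) (x : ℝ) :
    Matrix (Fin n) (Fin n) ℝ :=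
  fun i j => derivWithin (fun ζ => G ζ i j) (Icc a b) x

/-- The fundamental theorem of calculus for `w* G w`, where `w` is absolutely continuous and `G` is
a symmetric `C¹` matrix function. -/
theorem HasAEDeriv.integral_formRe {a b : ℝ} (hab : a < b)
    {w v : ℝ → EuclideanSpace 𝕜 (Fin n)} (h : HasAEDeriv a b w v)
    {G : ℝ → Matrix (Fin n) (Fin n) ℝ}
    (hG : ∀ i j, ContDiffOn ℝ 1 (fun ζ => G ζ i j) (Icc a b))
    (hsymm : ∀ ζ ∈ Icc a b, (G ζ).IsSymm) :
    ∫ ζ in Icc a b, (2 * formRe (G ζ) (w ζ) (v ζ) + formRe (matrixDeriv a b G ζ) (w ζ) (w ζ)) =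
      formRe (G b) (w b) (w b) - formRe (G a) (w a) (w a) := by
  have hu : uIcc a b = Icc a b := uIcc_of_le hab.le
  have hac : AbsolutelyContinuousOnInterval (fun ζ => formRe (G ζ) (w ζ) (w ζ)) a b := by
    simp only [formRe_eq_sum]
    refine absolutelyContinuous_sum _ fun i _ => absolutelyContinuous_sum _ fun j _ => ?_
    have h1 : AbsolutelyContinuousOnInterval (fun ζ => G ζ i j) a b := by
      refine ContDiffOn.absolutelyContinuousOnInterval ?_
      rw [hu]; exact hG i j
    exact h1.fun_mul (((h.re_ac i).fun_mul (h.re_ac j)).fun_add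
      ((h.im_ac i).fun_mul (h.im_ac j)))
  rw [← integral_eq_sub_of_absolutelyContinuous hac (f' := fun ζ =>
      2 * formRe (G ζ) (w ζ) (v ζ) + formRe (matrixDeriv a b G ζ) (w ζ) (w ζ)),
    intervalIntegral.integral_of_le hab.le, integral_Icc_eq_integral_Ioc]
  -- at the endpoints, only one-sided derivatives of `G` are available
  have hne : ∀ c : ℝ, ∀ᵐ x, x ≠ c := fun c => by
    simp [ae_iff]
  filter_upwards [ae_all_iff.2 h.re_deriv, ae_all_iff.2 h.im_deriv, hne a, hne b]
    with x hr hi hxa hxb hx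
  have hx' : x ∈ Icc a b := hu ▸ hx
  have hnhds : Icc a b ∈ 𝓝 x :=
    Icc_mem_nhds (lt_of_le_of_ne hx'.1 hxa.symm) (lt_of_le_of_ne hx'.2 hxb)
  have hGd : ∀ i j, HasDerivAt (fun ζ => G ζ i j) (matrixDeriv a b G x i j) x := fun i j =>
    (((hG i j).differentiableOn (by simp) x hx').hasDerivWithinAt).hasDerivAt hnhds
  have hd : HasDerivAt (fun ζ => formRe (G ζ) (w ζ) (w ζ)) (∑ i, ∑ j,
      (matrixDeriv a b G x i j *
        (RCLike.re (w x i) * RCLike.re (w x j) + RCLike.im (w x i) * RCLike.im (w x j)) +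
        G x i j * ((RCLike.re (v x i) * RCLike.re (w x j) + RCLike.re (w x i) * RCLike.re (v x j)) +
          (RCLike.im (v x i) * RCLike.im (w x j) + RCLike.im (w x i) * RCLike.im (v x j))))) x := by
    simp only [formRe_eq_sum]
    refine HasDerivAt.fun_sum fun i _ => HasDerivAt.fun_sum fun j _ => ?_
    exact (hGd i j).mul (((hr i hx).mul (hr j hx)).add ((hi i hx).mul (hi j hx)))
  convert! hd using 1
  have hsw : formRe (G x) (w x) (v x) = formRe (G x) (v x) (w x) := formRe_comm (hsymm x hx') _ _
  rw [two_mul]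
  nth_rewrite 2 [hsw]
  simp only [formRe_eq_sum, ← Finset.sum_add_distrib]
  refine Finset.sum_congr rfl fun i _ => Finset.sum_congr rfl fun j _ => ?_
  ring

theorem continuousOn_matrixDeriv {a b : ℝ} (hab : a < b) {G : ℝ → Matrix (Fin n) (Fin n) ℝ}
    (hG : ∀ i j, ContDiffOn ℝ 1 (fun ζ => G ζ i j) (Icc a b)) (i j : Fin n) :
    ContinuousOn (fun ζ => matrixDeriv a b G ζ i j) (Icc a b) :=
  (hG i j).continuousOn_derivWithin (uniqueDiffOn_Icc hab) (by simp)

theorem contDiffOn_matrix_det {s : Set ℝ} {m : ℕ} {G : ℝ → Matrix (Fin m) (Fin m) ℝ}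
    (hG : ∀ i j, ContDiffOn ℝ 1 (fun ζ => G ζ i j) s) :
    ContDiffOn ℝ 1 (fun ζ => (G ζ).det) s := by
  simp only [Matrix.det_apply]
  exact ContDiffOn.sum fun σ _ => (contDiffOn_prod fun i _ => hG _ _).const_smul _

theorem contDiffOn_matrix_inv {s : Set ℝ} {G : ℝ → Matrix (Fin n) (Fin n) ℝ}
    (hG : ∀ i j, ContDiffOn ℝ 1 (fun ζ => G ζ i j) s) (hu : ∀ ζ ∈ s, IsUnit (G ζ)) (i j : Fin n) :
    ContDiffOn ℝ 1 (fun ζ => (G ζ)⁻¹ i j) s := by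
  have hdet : ∀ ζ ∈ s, (G ζ).det ≠ 0 := fun ζ hζ =>
    ((Matrix.isUnit_iff_isUnit_det _).1 (hu ζ hζ)).ne_zero
  have hadj : ContDiffOn ℝ 1 (fun ζ => (G ζ).adjugate i j) s := by
    simp only [Matrix.adjugate_apply]
    refine contDiffOn_matrix_det fun k l => ?_
    by_cases hk : k = j
    · subst hk
      simpa using contDiffOn_const
    · simpa [Matrix.updateRow_ne hk] using hG k l
  have : ContDiffOn ℝ 1 (fun ζ => (G ζ).det⁻¹ * (G ζ).adjugate i j) s :=
    ((contDiffOn_matrix_det hG).inv hdet).mul hadj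
  simpa [Matrix.inv_def, Ring.inverse_eq_inv'] using this

end IntegrationByParts

/-! ### Quadratic forms on `L²` -/

section FormL2

variable {𝕜 : Type*} [RCLike 𝕜] {n : ℕ} {a b : ℝ}

/-- Entrywise continuity of a matrix function on `[a, b]`. -/
def ContMat (a b : ℝ) (K : ℝ → Matrix (Fin n) (Fin n) ℝ) : Prop :=
  ∀ i j, ContinuousOn (fun ζ => K ζ i j) (Icc a b)

theorem ContMat.const (P : Matrix (Fin n) (Fin n) ℝ) : ContMat a b fun _ => P :=
  fun _ _ => continuousOn_const

theorem ContMat.add {K L : ℝ → Matrix (Fin n) (Fin n) ℝ} (hK : ContMat a b K)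
    (hL : ContMat a b L) : ContMat a b fun ζ => K ζ + L ζ :=
  fun i j => (hK i j).add (hL i j)

theorem ContMat.sub {K L : ℝ → Matrix (Fin n) (Fin n) ℝ} (hK : ContMat a b K)
    (hL : ContMat a b L) : ContMat a b fun ζ => K ζ - L ζ :=
  fun i j => (hK i j).sub (hL i j)

theorem ContMat.smul {β : ℝ → ℝ} {K : ℝ → Matrix (Fin n) (Fin n) ℝ}
    (hβ : ContinuousOn β (Icc a b)) (hK : ContMat a b K) : ContMat a b fun ζ => β ζ • K ζ :=
  fun i j => hβ.mul (hK i j)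

theorem ContMat.mul {K L : ℝ → Matrix (Fin n) (Fin n) ℝ} (hK : ContMat a b K)
    (hL : ContMat a b L) : ContMat a b fun ζ => K ζ * L ζ := by
  intro i j
  simp only [Matrix.mul_apply]
  exact continuousOn_finsetSum _ fun k _ => (hK i k).mul (hL k j)

theorem ContMat.exists_bound {K : ℝ → Matrix (Fin n) (Fin n) ℝ} (hK : ContMat a b K) :
    ∃ C, 0 ≤ C ∧ ∀ ζ ∈ Icc a b, ∑ i, ∑ j, |K ζ i j| ≤ C := by
  have : ContinuousOn (fun ζ => ∑ i, ∑ j, |K ζ i j|) (Icc a b) :=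
    continuousOn_finsetSum _ fun i _ => continuousOn_finsetSum _ fun j _ => (hK i j).abs
  obtain ⟨C, hC⟩ := isCompact_Icc.exists_bound_of_continuousOn this
  exact ⟨max C 0, le_max_right _ _, fun ζ hζ =>
    ((le_abs_self _).trans (hC ζ hζ)).trans (le_max_left _ _)⟩

theorem ContMat.memLp_realAct {K : ℝ → Matrix (Fin n) (Fin n) ℝ} (hK : ContMat a b K)
    {f : ℝ → EuclideanSpace 𝕜 (Fin n)} (hf : MemLp f 2 (volume.restrict (Icc a b))) :
    MemLp (fun ζ => realAct (K ζ) (f ζ)) 2 (volume.restrict (Icc a b)) := by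
  obtain ⟨C, -, hC⟩ := hK.exists_bound
  refine MemLp.of_le_mul (c := C) hf ?_ ?_
  · have h1 : AEStronglyMeasurable (fun ζ => (fun i j => K ζ i j : Fin n → Fin n → ℝ))
        (volume.restrict (Icc a b)) :=
      (continuousOn_pi.2 fun i => continuousOn_pi.2 fun j => hK i j).aestronglyMeasurable
        measurableSet_Icc
    have h2 : Continuous fun p : (Fin n → Fin n → ℝ) × EuclideanSpace 𝕜 (Fin n) =>
        realAct (Matrix.of p.1) p.2 := by
      refine (PiLp.continuous_toLp 2 _).comp (continuous_pi fun i => ?_)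
      simp only [realMulVec, Matrix.mulVec, dotProduct, Matrix.map_apply, Matrix.of_apply]
      refine continuous_finsetSum _ fun j _ => ?_
      refine (RCLike.continuous_ofReal.comp ?_).mul ?_
      · exact (continuous_apply j).comp ((continuous_apply i).comp continuous_fst)
      · exact (EuclideanSpace.proj (𝕜 := 𝕜) j).continuous.comp continuous_snd
    have h3 := h2.comp_aestronglyMeasurable (h1.prodMk hf.1)
    exact h3.congr (ae_of_all _ fun ζ => rfl)
  · filter_upwards [ae_restrict_mem measurableSet_Icc] with ζ hζ
    exact (norm_realAct_le _ _).trans (mul_le_mul_of_nonneg_right (hC ζ hζ) (norm_nonneg _))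

/-- Multiplication by a continuous matrix function is a bounded operator on `L²`. -/
theorem ContMat.exists_mulOp (𝕜 : Type*) [RCLike 𝕜] {K : ℝ → Matrix (Fin n) (Fin n) ℝ}
    (hK : ContMat a b K) :
    ∃ M : L2 𝕜 n a b →L[𝕜] L2 𝕜 n a b, ∀ f : L2 𝕜 n a b,
      M f =ᵐ[volume.restrict (Icc a b)] fun ζ => realAct (K ζ) (f ζ) := by
  obtain ⟨C, hC0, hC⟩ := hK.exists_bound
  have hmem : ∀ f : L2 𝕜 n a b, MemLp (fun ζ => realAct (K ζ) (f ζ)) 2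
      (volume.restrict (Icc a b)) := fun f => hK.memLp_realAct (Lp.memLp f)
  let M₀ : L2 𝕜 n a b →ₗ[𝕜] L2 𝕜 n a b :=
    { toFun := fun f => (hmem f).toLp
      map_add' := by
        intro f g
        refine Lp.ext ?_
        filter_upwards [(hmem (f + g)).coeFn_toLp, (hmem f).coeFn_toLp, (hmem g).coeFn_toLp,
          Lp.coeFn_add f g, Lp.coeFn_add (hmem f).toLp (hmem g).toLp] with ζ h1 h2 h3 h4 h5
        rw [h1, h5, Pi.add_apply, h2, h3, h4, Pi.add_apply, realAct_add_right]
      map_smul' := by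
        intro c f
        refine Lp.ext ?_
        filter_upwards [(hmem (c • f)).coeFn_toLp, (hmem f).coeFn_toLp,
          Lp.coeFn_smul c f, Lp.coeFn_smul c (hmem f).toLp] with ζ h1 h2 h3 h4
        rw [h1, RingHom.id_apply, h4, Pi.smul_apply, h2, h3, Pi.smul_apply, realAct_smul_right] }
  refine ⟨M₀.mkContinuous C fun f => ?_, fun f => (hmem f).coeFn_toLp⟩
  refine Lp.norm_le_mul_norm_of_ae_le_mul ?_
  filter_upwards [(hmem f).coeFn_toLp, ae_restrict_mem measurableSet_Icc] with ζ h1 hζ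
  change ‖((hmem f).toLp _ : L2 𝕜 n a b) ζ‖ ≤ _
  rw [h1]
  exact (norm_realAct_le _ _).trans (mul_le_mul_of_nonneg_right (hC ζ hζ) (norm_nonneg _))

/-- The real part `Re ∫ f* K g` of the sesquilinear form of a matrix function `K` on `L²`. -/
noncomputable def formL2 (K : ℝ → Matrix (Fin n) (Fin n) ℝ) (f g : L2 𝕜 n a b) : ℝ :=
  ∫ ζ in Icc a b, formRe (K ζ) (f ζ) (g ζ)

/-- `formL2 K` is represented by a bounded operator, which gives its continuity and
differentiability along curves. -/
theorem ContMat.exists_formL2_eq (𝕜 : Type*) [RCLike 𝕜] {K : ℝ → Matrix (Fin n) (Fin n) ℝ}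
    (hK : ContMat a b K) :
    ∃ M : L2 𝕜 n a b →L[𝕜] L2 𝕜 n a b, ∀ f g : L2 𝕜 n a b,
      IntegrableOn (fun ζ => (inner 𝕜 (f ζ) (realAct (K ζ) (g ζ)) : 𝕜)) (Icc a b) ∧
      formL2 K f g = RCLike.re (inner 𝕜 f (M g)) := by
  obtain ⟨M, hM⟩ := hK.exists_mulOp 𝕜
  refine ⟨M, fun f g => ?_⟩
  have hae : (fun ζ => (inner 𝕜 (f ζ) (M g ζ) : 𝕜)) =ᵐ[volume.restrict (Icc a b)]
      fun ζ => inner 𝕜 (f ζ) (realAct (K ζ) (g ζ)) := by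
    filter_upwards [hM g] with ζ h
    rw [h]
  have hint := L2.integrable_inner (𝕜 := 𝕜) f (M g)
  refine ⟨hint.congr hae, ?_⟩
  rw [L2.inner_def, formL2, ← integral_re hint]
  refine integral_congr_ae ?_
  filter_upwards [hae] with ζ h
  rw [h, formRe]

theorem ContMat.integrable_inner {K : ℝ → Matrix (Fin n) (Fin n) ℝ} (hK : ContMat a b K)
    (f g : L2 𝕜 n a b) :
    IntegrableOn (fun ζ => (inner 𝕜 (f ζ) (realAct (K ζ) (g ζ)) : 𝕜)) (Icc a b) := by
  obtain ⟨M, hM⟩ := hK.exists_formL2_eq 𝕜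
  exact (hM f g).1

theorem ContMat.integrable_formRe {K : ℝ → Matrix (Fin n) (Fin n) ℝ} (hK : ContMat a b K)
    (f g : L2 𝕜 n a b) :
    IntegrableOn (fun ζ => formRe (K ζ) (f ζ) (g ζ)) (Icc a b) :=
  (hK.integrable_inner f g).re

theorem formL2_comm {K : ℝ → Matrix (Fin n) (Fin n) ℝ} (hs : ∀ ζ ∈ Icc a b, (K ζ).IsSymm)
    (f g : L2 𝕜 n a b) : formL2 K f g = formL2 K g f :=
  setIntegral_congr_fun measurableSet_Icc fun ζ hζ => formRe_comm (hs ζ hζ) _ _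

theorem ContMat.formL2_mono {K L : ℝ → Matrix (Fin n) (Fin n) ℝ} (hK : ContMat a b K)
    (hL : ContMat a b L)
    (h : ∀ ζ ∈ Icc a b, ∀ v : EuclideanSpace 𝕜 (Fin n), formRe (K ζ) v v ≤ formRe (L ζ) v v)
    (f : L2 𝕜 n a b) : formL2 K f f ≤ formL2 L f f :=
  setIntegral_mono_on (hK.integrable_formRe f f) (hL.integrable_formRe f f) measurableSet_Icc
    fun ζ hζ => h ζ hζ _

theorem formL2_smul (c : ℝ) (K : ℝ → Matrix (Fin n) (Fin n) ℝ) (f g : L2 𝕜 n a b) :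
    formL2 (fun ζ => c • K ζ) f g = c * formL2 K f g := by
  simp only [formL2, formRe_smul_matrix]
  exact integral_const_mul _ _

theorem ContMat.abs_formL2_le {K L : ℝ → Matrix (Fin n) (Fin n) ℝ} (hK : ContMat a b K)
    (hL : ContMat a b L) {c : ℝ}
    (h : ∀ ζ ∈ Icc a b, ∀ v : EuclideanSpace 𝕜 (Fin n),
      |formRe (K ζ) v v| ≤ c * formRe (L ζ) v v)
    (f : L2 𝕜 n a b) : |formL2 K f f| ≤ c * formL2 L f f := by
  rw [abs_le, ← neg_mul, ← formL2_smul, ← formL2_smul]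
  constructor
  · refine ContMat.formL2_mono (ContMat.smul continuousOn_const hL) hK (fun ζ hζ v => ?_) f
    rw [formRe_smul_matrix, neg_mul]
    exact (abs_le.1 (h ζ hζ v)).1
  · refine ContMat.formL2_mono hK (ContMat.smul continuousOn_const hL) (fun ζ hζ v => ?_) f
    rw [formRe_smul_matrix]
    exact (abs_le.1 (h ζ hζ v)).2

theorem ContMat.continuousOn_formL2 {K : ℝ → Matrix (Fin n) (Fin n) ℝ} (hK : ContMat a b K)
    {s : Set ℝ} {x y : ℝ → L2 𝕜 n a b} (hx : ContinuousOn x s) (hy : ContinuousOn y s) :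
    ContinuousOn (fun t => formL2 K (x t) (y t)) s := by
  obtain ⟨M, hM⟩ := hK.exists_formL2_eq 𝕜
  simp only [fun f g => (hM f g).2]
  exact RCLike.continuous_re.comp_continuousOn (hx.inner (M.continuous.comp_continuousOn hy))

theorem ContMat.hasDerivWithinAt_formL2 {K : ℝ → Matrix (Fin n) (Fin n) ℝ} (hK : ContMat a b K)
    (hs : ∀ ζ ∈ Icc a b, (K ζ).IsSymm) {x : ℝ → L2 𝕜 n a b} {y : L2 𝕜 n a b} {s : Set ℝ} {t : ℝ}
    (hx : HasDerivWithinAt x y s t) :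
    HasDerivWithinAt (fun t => formL2 K (x t) (x t)) (2 * formL2 K (x t) y) s t := by
  obtain ⟨M, hM⟩ := hK.exists_formL2_eq 𝕜
  have h1 : HasDerivWithinAt (fun t => M (x t)) (M y) s t :=
    (M.restrictScalars ℝ).hasFDerivAt.comp_hasDerivWithinAt t hx
  have h2 := hx.inner 𝕜 h1
  have h3 := (RCLike.reCLM (K := 𝕜)).hasFDerivAt.comp_hasDerivWithinAt t h2
  have h4 : HasDerivWithinAt (fun t => formL2 K (x t) (x t))
      (RCLike.re (inner 𝕜 (x t) (M y) + inner 𝕜 y (M (x t)))) s t := by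
    simp only [fun f g => (hM f g).2]
    exact h3
  rw [map_add, ← (hM _ _).2, ← (hM _ _).2, formL2_comm hs y, ← two_mul] at h4
  exact h4

end FormL2

/-! ### Orbits of a semigroup and the domain of its generator -/

section Semigroup

variable {𝕜 X : Type*} [RCLike 𝕜] [NormedAddCommGroup X] [NormedSpace 𝕜 X]
  {T : ℝ → X →L[𝕜] X} {A : X → X → Prop}

theorem IsGenerator.map (hT : IsC0Semigroup T) (hA : IsGenerator T A) {x y : X} (h : A x y)
    {t : ℝ} (ht : 0 ≤ t) : A (T t x) (T t y) := by
  rw [hA] at h ⊢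
  refine (((T t).continuous.tendsto y).comp h).congr' ?_
  filter_upwards [self_mem_nhdsWithin] with s hs
  have hs : 0 ≤ s := le_of_lt hs
  have h1 : T t (T s x) = T s (T t x) := by
    rw [← ContinuousLinearMap.comp_apply, ← hT.add t s ht hs, add_comm, hT.add s t hs ht,
      ContinuousLinearMap.comp_apply]
  simp only [Function.comp_apply, map_smul, map_sub, h1]

variable [NormedSpace ℝ X] [IsScalarTower ℝ 𝕜 X]

theorem IsGenerator.iff_tendsto_real (hA : IsGenerator T A) (x y : X) :
    A x y ↔ Tendsto (fun t : ℝ => t⁻¹ • (T t x - x)) (𝓝[>] 0) (𝓝 y) := by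
  rw [hA x y]
  have : (fun t : ℝ => ((t⁻¹ : ℝ) : 𝕜) • (T t x - x)) = fun t : ℝ => t⁻¹ • (T t x - x) := by
    ext t
    exact algebraMap_smul 𝕜 t⁻¹ (T t x - x)
  rw [this]

/-- Orbits in the domain are differentiable from the right, which is all that the definition of the
generator gives directly. -/
theorem IsGenerator.hasDerivWithinAt (hT : IsC0Semigroup T) (hA : IsGenerator T A) {x y : X}
    (h : A x y) {t : ℝ} (ht : 0 ≤ t) :
    HasDerivWithinAt (fun s => T s x) (T t y) (Ioi t) t := by
  rw [hasDerivWithinAt_iff_tendsto_slope' (by simp)]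
  have h1 := (hA.iff_tendsto_real _ _).1 (hA.map hT h ht)
  have h2 : Tendsto (fun s : ℝ => s - t) (𝓝[>] t) (𝓝[>] 0) := by
    refine tendsto_nhdsWithin_of_tendsto_nhds_of_eventually_within _ ?_ ?_
    · exact ((continuous_id.sub continuous_const).tendsto' t 0 (by simp)).mono_left
        nhdsWithin_le_nhds
    · filter_upwards [self_mem_nhdsWithin] with s hs
      exact sub_pos.2 (mem_Ioi.1 hs)
  refine (h1.comp h2).congr' ?_
  filter_upwards [self_mem_nhdsWithin] with s hs
  have hs' : 0 ≤ s - t := (sub_pos.2 (mem_Ioi.1 hs)).le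
  have h3 : T (s - t) (T t x) = T s x := by
    rw [← ContinuousLinearMap.comp_apply, ← hT.add (s - t) t hs' ht, sub_add_cancel]
  simp only [Function.comp_apply, slope_def_module, h3]

/-- The averages `t⁻¹ ∫₀ᵗ T(s) x ds` lie in the domain of the generator and tend to `x`. -/
theorem IsGenerator.dense_domain [CompleteSpace X] (hT : IsC0Semigroup T) (hA : IsGenerator T A) :
    Dense {x | ∃ y, A x y} := by
  intro x
  have hint : ∀ p q : ℝ, 0 ≤ p → 0 ≤ q → IntervalIntegrable (fun s => T s x) volume p q := by
    intro p q hp hq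
    refine ((hT.continuousOn x).mono fun s hs => ?_).intervalIntegrable
    exact (le_min hp hq).trans hs.1
  have hder : ∀ t : ℝ, 0 ≤ t → Tendsto (fun h : ℝ => h⁻¹ • ∫ s in t..t + h, T s x) (𝓝[>] 0)
      (𝓝 (T t x)) := by
    intro t ht
    have hmeas : StronglyMeasurableAtFilter (fun s => T s x) (𝓝[>] t) :=
      ⟨Ioi t, self_mem_nhdsWithin, ((hT.continuousOn x).mono fun s hs =>
        ht.trans (le_of_lt hs)).aestronglyMeasurable measurableSet_Ioi⟩
    have hcont : ContinuousWithinAt (fun s => T s x) (Ioi t) t :=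
      ((hT.continuousOn x) t ht).mono fun s hs => ht.trans (le_of_lt hs)
    have h1 : HasDerivWithinAt (fun u => ∫ s in t..u, T s x) (T t x) (Ici t) t :=
      intervalIntegral.integral_hasDerivWithinAt_right (by simp) hmeas hcont
    have h2 := (h1.mono Ioi_subset_Ici_self)
    rw [hasDerivWithinAt_iff_tendsto_slope' (by simp)] at h2
    have h3 : Tendsto (fun h : ℝ => t + h) (𝓝[>] 0) (𝓝[>] t) := by
      refine tendsto_nhdsWithin_of_tendsto_nhds_of_eventually_within _ ?_ ?_
      · exact ((continuous_const.add continuous_id).tendsto' 0 t (by simp)).mono_left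
          nhdsWithin_le_nhds
      · filter_upwards [self_mem_nhdsWithin] with s hs
        exact lt_add_of_pos_right t hs
    refine (h2.comp h3).congr fun h => ?_
    simp [slope_def_module]
  have hdom : ∀ t : ℝ, 0 < t → A (∫ s in (0 : ℝ)..t, T s x) (T t x - x) := by
    intro t ht
    rw [hA.iff_tendsto_real]
    have h0 := hder 0 le_rfl
    rw [hT.zero] at h0
    refine ((hder t ht.le).sub h0).congr' ?_
    filter_upwards [self_mem_nhdsWithin] with h hh
    have hh : 0 < h := hh
    have h1 : T h (∫ s in (0 : ℝ)..t, T s x) = ∫ s in h..t + h, T s x := by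
      have e1 : T h (∫ s in (0 : ℝ)..t, T s x) = ∫ s in (0 : ℝ)..t, T h (T s x) :=
        (((T h).restrictScalars ℝ).intervalIntegral_comp_comm (hint 0 t le_rfl ht.le)).symm
      have e2 : ∫ s in (0 : ℝ)..t, T h (T s x) = ∫ s in (0 : ℝ)..t, T (s + h) x := by
        refine intervalIntegral.integral_congr fun s hs => ?_
        rw [uIcc_of_le ht.le] at hs
        rw [add_comm, hT.add h s hh.le hs.1, ContinuousLinearMap.comp_apply]
      rw [e1, e2, intervalIntegral.integral_comp_add_right (fun s => T s x), zero_add]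
    have h2 := intervalIntegral.integral_add_adjacent_intervals (hint 0 h le_rfl hh.le)
      (hint h (t + h) hh.le (by linarith))
    have h3 := intervalIntegral.integral_add_adjacent_intervals (hint 0 t le_rfl ht.le)
      (hint t (t + h) ht.le (by linarith))
    rw [h1, zero_add, ← smul_sub]
    congr 1
    rw [sub_eq_sub_iff_add_eq_add, add_comm (∫ s in t..t + h, T s x), h3, ← h2]
    exact add_comm _ _
  have hlim : Tendsto (fun t : ℝ => t⁻¹ • ∫ s in (0 : ℝ)..t, T s x) (𝓝[>] 0) (𝓝 x) := by
    have h0 := hder 0 le_rfl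
    rw [hT.zero] at h0
    simpa using h0
  refine mem_closure_of_tendsto hlim ?_
  filter_upwards [self_mem_nhdsWithin] with t ht
  refine ⟨t⁻¹ • (T t x - x), ?_⟩
  have h1 := (hA.iff_tendsto_real _ _).1 (hdom t ht)
  rw [hA.iff_tendsto_real]
  refine (h1.const_smul t⁻¹).congr fun s => ?_
  have h2 : T s (t⁻¹ • ∫ s in (0 : ℝ)..t, T s x) = t⁻¹ • T s (∫ s in (0 : ℝ)..t, T s x) :=
    map_smul ((T s).restrictScalars ℝ) _ _
  rw [h2, ← smul_sub, smul_comm]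

end Semigroup

/-! ### Energy balance and multiplier identity -/

namespace PHSystem

variable {𝕜 : Type*} [RCLike 𝕜] {n : ℕ} {S : PHSystem n}

namespace StandingAssumptions

theorem contMat_H (hS : S.StandingAssumptions) : ContMat S.a S.b S.H :=
  fun i j => (hS.H_contDiff i j).continuousOn

theorem isUnit_H (hS : S.StandingAssumptions) {ζ : ℝ} (hζ : ζ ∈ Icc S.a S.b) :
    IsUnit (S.H ζ) := by
  obtain ⟨m, M, hm, -, h⟩ := hS.H_bounds
  have h1 : (m • (1 : Matrix (Fin n) (Fin n) ℝ)).PosDef := Matrix.PosDef.one.smul hm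
  have h2 := Matrix.PosDef.posSemidef_add (h ζ hζ).1 h1
  rw [sub_add_cancel] at h2
  exact h2.isUnit

theorem formRe_H_bounds (hS : S.StandingAssumptions) : ∃ m M : ℝ, 0 < m ∧ 0 < M ∧
    ∀ ζ ∈ Icc S.a S.b, ∀ v : EuclideanSpace 𝕜 (Fin n),
      m * ‖v‖ ^ 2 ≤ formRe (S.H ζ) v v ∧ formRe (S.H ζ) v v ≤ M * ‖v‖ ^ 2 := by
  obtain ⟨m, M, hm, hM, h⟩ := hS.H_bounds
  refine ⟨m, M, hm, hM, fun ζ hζ v => ⟨?_, ?_⟩⟩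
  · have := formRe_self_nonneg (h ζ hζ).1 v
    rw [formRe_sub_matrix, formRe_smul_matrix, formRe_one] at this
    linarith
  · have := formRe_self_nonneg (h ζ hζ).2 v
    rw [formRe_sub_matrix, formRe_smul_matrix, formRe_one] at this
    linarith

theorem formRe_H_nonneg (hS : S.StandingAssumptions) {ζ : ℝ} (hζ : ζ ∈ Icc S.a S.b)
    (v : EuclideanSpace 𝕜 (Fin n)) : 0 ≤ formRe (S.H ζ) v v := by
  obtain ⟨m, M, hm, -, h⟩ := hS.formRe_H_bounds (𝕜 := 𝕜)
  exact (by positivity : 0 ≤ m * ‖v‖ ^ 2).trans (h ζ hζ v).1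

theorem isSymm_inv_P₁ (hS : S.StandingAssumptions) : (S.P₁⁻¹).IsSymm := by
  rw [Matrix.IsSymm, Matrix.transpose_nonsing_inv, hS.P₁_symm.eq]

end StandingAssumptions

theorem exists_opGraph {x : L2 𝕜 n S.a S.b}
    (hx : x ∈ S.domain 𝕜) : ∃ y, S.opGraph 𝕜 x y := by
  obtain ⟨v, hv⟩ := hx.1
  have h1 := ((ContMat.const S.P₁).memLp_realAct hv.memLp_deriv).add
    ((ContMat.const S.P₀).memLp_realAct hv.memLp)
  exact ⟨h1.toLp _, hx, v, hv, h1.coeFn_toLp⟩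

/-- The energy density in terms of the continuous representative `w` of `H x`, since `H⁻¹ w` is the
continuous representative of `x`. -/
theorem energyDensityAt_eq (hS : S.StandingAssumptions) {x : L2 𝕜 n S.a S.b}
    {w : ℝ → EuclideanSpace 𝕜 (Fin n)} (hw : ContinuousOn w (Icc S.a S.b))
    (hxw : S.mulH x =ᵐ[volume.restrict (Icc S.a S.b)] w) {δ : ℝ} (hδ : δ ∈ Icc S.a S.b) :
    S.energyDensityAt x δ = formRe (S.H δ)⁻¹ (w δ) (w δ) := by
  have hcont : ContinuousOn (fun ζ => realAct (S.H ζ)⁻¹ (w ζ)) (Icc S.a S.b) := by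
    refine (PiLp.continuous_toLp 2 _).comp_continuousOn (continuousOn_pi.2 fun i => ?_)
    simp only [realMulVec, Matrix.mulVec, dotProduct, Matrix.map_apply]
    refine continuousOn_finsetSum _ fun j _ => ?_
    exact (RCLike.continuous_ofReal.comp_continuousOn (contDiffOn_matrix_inv hS.H_contDiff
      (fun ζ hζ => hS.isUnit_H hζ) i j).continuousOn).mul
      ((EuclideanSpace.proj (𝕜 := 𝕜) j).continuous.comp_continuousOn hw)
  have hae : x =ᵐ[volume.restrict (Icc S.a S.b)] fun ζ => realAct (S.H ζ)⁻¹ (w ζ) := by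
    filter_upwards [hxw, ae_restrict_mem measurableSet_Icc] with ζ h1 h2
    rw [← h1, mulH, realAct_inv_realAct (hS.isUnit_H h2)]
  have hH : realAct (S.H δ) (realAct (S.H δ)⁻¹ (w δ)) = w δ := by
    rw [← realAct_mul, Matrix.mul_nonsing_inv _
      ((Matrix.isUnit_iff_isUnit_det _).1 (hS.isUnit_H hδ)), realAct_one]
  rw [energyDensityAt, contRep_eqOn hS.lt hcont hae hδ, hH, formRe, ← inner_conj_symm,
    RCLike.conj_re]

theorem energyDensityAt_nonneg (hS : S.StandingAssumptions) (x : L2 𝕜 n S.a S.b) {δ : ℝ}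
    (hδ : δ ∈ Icc S.a S.b) : 0 ≤ S.energyDensityAt x δ :=
  hS.formRe_H_nonneg hδ _

/-- `formL2 S.H x x` is twice the energy. -/
theorem energyNorm_sq (hS : S.StandingAssumptions) (x : L2 𝕜 n S.a S.b) :
    S.energyNorm x ^ 2 = 1 / 2 * formL2 S.H x x := by
  have h1 : RCLike.re (S.energyInner x x) = 1 / 2 * formL2 S.H x x := by
    have h2 : (1 / 2 : 𝕜) = ((1 / 2 : ℝ) : 𝕜) := by push_cast; rfl
    have h3 : formL2 S.H x x = RCLike.re (∫ ζ in Icc S.a S.b, inner 𝕜 (x ζ) (S.mulH x ζ)) :=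
      integral_re (hS.contMat_H.integrable_inner x x)
    rw [energyInner, h2, RCLike.re_ofReal_mul, h3]
  have h4 : 0 ≤ formL2 S.H x x :=
    setIntegral_nonneg measurableSet_Icc fun ζ hζ => hS.formRe_H_nonneg hζ _
  rw [energyNorm, Real.sq_sqrt (by rw [h1]; positivity), h1]

/-- The energy balance `Re ⟨A x, H x⟩ = ½ [(H x)* P₁ (H x)]_a^b` and the boundary conditions make
`A` dissipative for the energy inner product. -/
theorem formL2_H_nonpos (hS : S.StandingAssumptions) {x y : L2 𝕜 n S.a S.b}
    (h : S.opGraph 𝕜 x y) : formL2 S.H x y ≤ 0 := by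
  obtain ⟨hx, v, hv, hy⟩ := h
  obtain ⟨w, hxw, hw⟩ := hv.exists_hasAEDeriv hS.lt
  have hwc := hw.continuousOn hS.lt.le
  have hbal := hw.integral_formRe hS.lt (G := fun _ => S.P₁) (fun _ _ => contDiffOn_const)
    (fun _ _ => hS.P₁_symm)
  have hint : ∫ ζ in Icc S.a S.b, (2 * formRe S.P₁ (w ζ) (v ζ) +
      formRe (matrixDeriv S.a S.b (fun _ => S.P₁) ζ) (w ζ) (w ζ)) = 2 * formL2 S.H x y := by
    rw [formL2, ← integral_const_mul]
    refine integral_congr_ae ?_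
    filter_upwards [hxw, hy, ae_restrict_mem measurableSet_Icc] with ζ h1 h2 hζ
    have hd : matrixDeriv S.a S.b (fun _ => S.P₁) ζ = 0 := by
      ext i j; simp [matrixDeriv]
    have h3 : formRe S.P₁ (w ζ) (v ζ) = formRe (S.H ζ) (x ζ) (y ζ) := by
      have e1 : realAct S.P₁ (v ζ) = y ζ - realAct S.P₀ (w ζ) := by
        rw [h2, h1, add_sub_cancel_right]
      have e2 : formRe S.P₁ (w ζ) (v ζ) = formRe 1 (w ζ) (y ζ) - formRe S.P₀ (w ζ) (w ζ) := by
        rw [formRe, e1, inner_sub_right, map_sub, formRe, formRe, realAct_one]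
      rw [e2, formRe_self_of_skew hS.P₀_skew, sub_zero, ← h1, mulH, formRe_realAct_left, mul_one,
        (hS.H_symm ζ hζ).eq]
    rw [h3, hd, ← zero_smul ℝ (1 : Matrix (Fin n) (Fin n) ℝ), formRe_smul_matrix]
    ring
  rw [hint] at hbal
  -- the boundary terms are the form of the exchange matrix at the boundary port variables
  set J : Matrix (Fin n ⊕ Fin n) (Fin n ⊕ Fin n) ℝ := Matrix.fromBlocks 0 1 1 0 with hJ
  have hport : ∀ p q : Fin n → ℝ,
      ((((1 / √2 : ℝ) • Matrix.fromBlocks 1 1 S.P₁ (-S.P₁) :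
        Matrix (Fin n ⊕ Fin n) (Fin n ⊕ Fin n) ℝ) *ᵥ Sum.elim p q) ⬝ᵥ J *ᵥ
      (((1 / √2 : ℝ) • Matrix.fromBlocks 1 1 S.P₁ (-S.P₁) :
        Matrix (Fin n ⊕ Fin n) (Fin n ⊕ Fin n) ℝ) *ᵥ Sum.elim p q)) =
      p ⬝ᵥ S.P₁ *ᵥ p - q ⬝ᵥ S.P₁ *ᵥ q := by
    intro p q
    have hsym : q ⬝ᵥ S.P₁ *ᵥ p = p ⬝ᵥ S.P₁ *ᵥ q := by
      rw [Matrix.dotProduct_mulVec, ← Matrix.mulVec_transpose, hS.P₁_symm.eq, dotProduct_comm]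
    have hs : (1 / √2 : ℝ) * (1 / √2) = 1 / 2 := by
      rw [div_mul_div_comm, one_mul, Real.mul_self_sqrt (by norm_num)]
    have hc1 : (S.P₁ *ᵥ p) ⬝ᵥ p = p ⬝ᵥ S.P₁ *ᵥ p := dotProduct_comm _ _
    have hc2 : (S.P₁ *ᵥ q) ⬝ᵥ q = q ⬝ᵥ S.P₁ *ᵥ q := dotProduct_comm _ _
    have hc3 : (S.P₁ *ᵥ p) ⬝ᵥ q = p ⬝ᵥ S.P₁ *ᵥ q := (dotProduct_comm _ _).trans hsym
    have hc4 : (S.P₁ *ᵥ q) ⬝ᵥ p = p ⬝ᵥ S.P₁ *ᵥ q := dotProduct_comm _ _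
    simp only [hJ, Matrix.smul_mulVec, Matrix.mulVec_smul, smul_dotProduct, dotProduct_smul,
      smul_eq_mul, Matrix.fromBlocks_mulVec, Sum.elim_comp_inl, Sum.elim_comp_inr,
      Matrix.one_mulVec, Matrix.zero_mulVec, Matrix.neg_mulVec, zero_add, add_zero,
      sumElim_dotProduct_sumElim, add_dotProduct, dotProduct_add, neg_dotProduct,
      dotProduct_neg, hc1, hc2, hc3, hc4, hsym]
    linear_combination (2 * (p ⬝ᵥ S.P₁ *ᵥ p) - 2 * (q ⬝ᵥ S.P₁ *ᵥ q)) * hs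
  have hb := contRep_eqOn hS.lt hwc hxw (right_mem_Icc.2 hS.lt.le)
  have ha := contRep_eqOn hS.lt hwc hxw (left_mem_Icc.2 hS.lt.le)
  have hbc := hx.2
  rw [boundaryPort, ha, hb] at hbc
  have hre := dotProduct_exchange_nonpos_of_mulVec_eq_zero S.WB hS.rank_WB hS.WB_nonneg _
    ((re_realMulVec S.WB _).symm.trans (by rw [hbc]; ext; simp))
  have him := dotProduct_exchange_nonpos_of_mulVec_eq_zero S.WB hS.rank_WB hS.WB_nonneg _
    ((im_realMulVec S.WB _).symm.trans (by rw [hbc]; ext; simp))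
  have hel : ∀ (φ : 𝕜 → ℝ) (p q : Fin n → 𝕜), (fun j => φ (Sum.elim p q j)) =
      Sum.elim (fun i => φ (p i)) (fun i => φ (q i)) := by
    intro φ p q; ext (j | j) <;> rfl
  rw [re_realMulVec, hel, hport] at hre
  rw [im_realMulVec, hel, hport] at him
  simp only [formRe_eq_dotProduct] at hbal
  linarith

/-- The lower-order coefficient `H (H⁻¹)' H - 2 P₁⁻¹ P₀ H` that appears when `x* H x` is
differentiated along the interval. -/
noncomputable def lowerCoeff (S : PHSystem n) (ζ : ℝ) : Matrix (Fin n) (Fin n) ℝ :=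
  S.H ζ * matrixDeriv S.a S.b (fun ζ => (S.H ζ)⁻¹) ζ * S.H ζ -
    (2 : ℝ) • (S.P₁⁻¹ * S.P₀ * S.H ζ)

theorem contMat_lowerCoeff (hS : S.StandingAssumptions) : ContMat S.a S.b S.lowerCoeff := by
  have hD : ContMat S.a S.b (matrixDeriv S.a S.b fun ζ => (S.H ζ)⁻¹) :=
    continuousOn_matrixDeriv hS.lt (contDiffOn_matrix_inv hS.H_contDiff fun ζ hζ => hS.isUnit_H hζ)
  exact ((hS.contMat_H.mul hD).mul hS.contMat_H).sub
    (((ContMat.const _).mul hS.contMat_H).smul (β := fun _ => 2) continuousOn_const)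

/-- Multiplier identity: integration by parts in `∫ (β x* H x)'`, where the derivative of `H x` is
expressed through `y = A x`. -/
theorem boundary_identity (hS : S.StandingAssumptions) {x y : L2 𝕜 n S.a S.b}
    (h : S.opGraph 𝕜 x y) {β : ℝ → ℝ} (hβ : ContDiff ℝ 1 β) :
    β S.b * S.energyDensityAt x S.b - β S.a * S.energyDensityAt x S.a =
      2 * formL2 (fun ζ => β ζ • S.P₁⁻¹) x y +
        formL2 (fun ζ => deriv β ζ • S.H ζ + β ζ • S.lowerCoeff ζ) x x := by
  obtain ⟨hx, v, hv, hy⟩ := h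
  obtain ⟨w, hxw, hw⟩ := hv.exists_hasAEDeriv hS.lt
  have hwc := hw.continuousOn hS.lt.le
  have hinv := contDiffOn_matrix_inv hS.H_contDiff (fun ζ hζ => hS.isUnit_H hζ)
  have hinvs : ∀ ζ ∈ Icc S.a S.b, ((S.H ζ)⁻¹).IsSymm := fun ζ hζ => by
    rw [Matrix.IsSymm, Matrix.transpose_nonsing_inv, (hS.H_symm ζ hζ).eq]
  have hbal := hw.integral_formRe hS.lt (G := fun ζ => β ζ • (S.H ζ)⁻¹)
    (fun i j => hβ.contDiffOn.mul (hinv i j)) (fun ζ hζ => (hinvs ζ hζ).smul _)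
  rw [energyDensityAt_eq hS hwc hxw (right_mem_Icc.2 hS.lt.le),
    energyDensityAt_eq hS hwc hxw (left_mem_Icc.2 hS.lt.le), ← formRe_smul_matrix,
    ← formRe_smul_matrix, ← hbal, formL2, formL2, ← integral_const_mul]
  have hc1 : ContMat S.a S.b (fun ζ => β ζ • S.P₁⁻¹) :=
    ContMat.smul hβ.continuous.continuousOn (ContMat.const _)
  have hc2 : ContMat S.a S.b (fun ζ => deriv β ζ • S.H ζ + β ζ • S.lowerCoeff ζ) :=
    (ContMat.smul (hβ.continuous_deriv le_rfl).continuousOn hS.contMat_H).add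
      (ContMat.smul hβ.continuous.continuousOn (contMat_lowerCoeff hS))
  rw [← integral_add ((hc1.integrable_formRe x y).const_mul 2) (hc2.integrable_formRe x x)]
  refine integral_congr_ae ?_
  filter_upwards [hxw, hy, ae_restrict_mem measurableSet_Icc] with ζ h1 h2 hζ
  have hd : matrixDeriv S.a S.b (fun ζ => β ζ • (S.H ζ)⁻¹) ζ = deriv β ζ • (S.H ζ)⁻¹ +
      β ζ • matrixDeriv S.a S.b (fun ζ => (S.H ζ)⁻¹) ζ := by
    ext i j
    have e1 : HasDerivWithinAt β (deriv β ζ) (Icc S.a S.b) ζ :=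
      ((hβ.differentiable (by simp)) ζ).hasDerivAt.hasDerivWithinAt
    have e2 := ((hinv i j).differentiableOn (by simp) ζ hζ).hasDerivWithinAt
    exact (e1.mul e2).derivWithin (uniqueDiffOn_Icc hS.lt ζ hζ)
  have hHt : (S.H ζ)ᵀ = S.H ζ := (hS.H_symm ζ hζ).eq
  have hdet := (Matrix.isUnit_iff_isUnit_det _).1 (hS.isUnit_H hζ)
  have hwx : w ζ = realAct (S.H ζ) (x ζ) := h1.symm
  have hvy : v ζ = realAct S.P₁⁻¹ (y ζ) - realAct (S.P₁⁻¹ * S.P₀ * S.H ζ) (x ζ) := by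
    rw [h2, realAct_add_right, realAct_inv_realAct hS.P₁_invertible, mulH, ← realAct_mul,
      ← realAct_mul, add_sub_cancel_right]
  rw [hd, hwx, hvy]
  simp only [formRe_add_matrix, formRe_smul_matrix, formRe_sub_right, formRe_realAct_left,
    formRe_realAct_right, lowerCoeff, formRe_sub_matrix, hHt, Matrix.smul_mul,
    Matrix.mul_smul, Matrix.add_mul, Matrix.mul_add, ← Matrix.mul_assoc,
    Matrix.mul_nonsing_inv _ hdet, Matrix.one_mul]
  ring

end PHSystem

/-! ### Contractivity, and weights adapted to an endpoint -/

namespace PHSystem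

variable {𝕜 : Type*} [RCLike 𝕜] {n : ℕ} {S : PHSystem n}
  {T : ℝ → L2 𝕜 n S.a S.b →L[𝕜] L2 𝕜 n S.a S.b}

theorem continuous_formL2_H (hS : S.StandingAssumptions)
    (L : L2 𝕜 n S.a S.b →L[𝕜] L2 𝕜 n S.a S.b) :
    Continuous fun x : L2 𝕜 n S.a S.b => formL2 S.H (L x) (L x) := by
  obtain ⟨M, hM⟩ := hS.contMat_H.exists_formL2_eq 𝕜
  simp only [fun f g => (hM f g).2]
  fun_prop

theorem formL2_H_self_nonneg (hS : S.StandingAssumptions) (x : L2 𝕜 n S.a S.b) :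
    0 ≤ formL2 S.H x x :=
  setIntegral_nonneg measurableSet_Icc fun _ hζ => hS.formRe_H_nonneg hζ _

theorem continuousOn_orbit (hT : IsC0Semigroup T) {t₀ t₁ : ℝ} (h0 : 0 ≤ t₀)
    (x : L2 𝕜 n S.a S.b) : ContinuousOn (fun t => T t x) (Icc t₀ t₁) :=
  (hT.continuousOn x).mono fun _ hs => h0.trans hs.1

/-- The semigroup is contractive for the energy. -/
theorem formL2_H_semigroup_le (hS : S.StandingAssumptions) (hT : IsC0Semigroup T)
    (hA : IsGenerator T (S.opGraph 𝕜)) {t : ℝ} (ht : 0 ≤ t) (x : L2 𝕜 n S.a S.b) :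
    formL2 S.H (T t x) (T t x) ≤ formL2 S.H x x := by
  have hclosed : IsClosed {x : L2 𝕜 n S.a S.b | formL2 S.H (T t x) (T t x) ≤ formL2 S.H x x} :=
    isClosed_le (continuous_formL2_H hS (T t))
      (continuous_formL2_H hS (ContinuousLinearMap.id 𝕜 _))
  refine hclosed.closure_subset_iff.2 ?_ (IsGenerator.dense_domain hT hA x)
  rintro x ⟨y, hxy⟩
  have hX := continuousOn_orbit (t₁ := t) hT le_rfl x
  have hY := continuousOn_orbit (t₁ := t) hT le_rfl y
  have h1 := intervalIntegral.integral_eq_sub_of_hasDeriv_right_of_le ht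
    (hS.contMat_H.continuousOn_formL2 hX hX)
    (fun r hr => hS.contMat_H.hasDerivWithinAt_formL2 hS.H_symm
      (IsGenerator.hasDerivWithinAt hT hA hxy hr.1.le))
    (((hS.contMat_H.continuousOn_formL2 hX hY).const_mul 2).intervalIntegrable_of_Icc ht)
  have h2 : ∫ r in (0 : ℝ)..t, 2 * formL2 S.H (T r x) (T r y) ≤ 0 := by
    rw [intervalIntegral.integral_of_le ht]
    refine setIntegral_nonpos measurableSet_Ioc fun r hr => ?_
    have := formL2_H_nonpos hS (hA.map hT hxy hr.1.le)
    linarith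
  rw [h1, hT.zero] at h2
  exact sub_nonpos.1 h2

theorem formL2_H_semigroup_anti (hS : S.StandingAssumptions) (hT : IsC0Semigroup T)
    (hA : IsGenerator T (S.opGraph 𝕜)) {s t : ℝ} (hs : 0 ≤ s) (hst : s ≤ t)
    (x : L2 𝕜 n S.a S.b) :
    formL2 S.H (T t x) (T t x) ≤ formL2 S.H (T s x) (T s x) := by
  have h1 : T t x = T (t - s) (T s x) := by
    rw [← ContinuousLinearMap.comp_apply, ← hT.add _ _ (sub_nonneg.2 hst) hs, sub_add_cancel]
  rw [h1]
  exact formL2_H_semigroup_le hS hT hA (sub_nonneg.2 hst) _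

/-- A contraction semigroup for the energy which is a strict contraction at one time is
exponentially stable. -/
theorem exponentiallyStable_of_strict_contraction (hS : S.StandingAssumptions)
    (hT : IsC0Semigroup T) (hA : IsGenerator T (S.opGraph 𝕜)) {T₁ r : ℝ} (hT₁ : 0 < T₁)
    (hr : 0 < r) (hr1 : r < 1)
    (h : ∀ x, formL2 S.H (T T₁ x) (T T₁ x) ≤ r * formL2 S.H x x) :
    S.ExponentiallyStable T := by
  -- the rate for which `r = e^{-2 η T₁}`; the energy is the square of the norm
  set η := -Real.log r / (2 * T₁) with hη
  have hη0 : 0 < η := div_pos (neg_pos.2 (Real.log_neg hr hr1)) (by positivity)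
  have hrη : r = Real.exp (-(2 * η * T₁)) := by
    rw [hη]
    have : -(2 * (-Real.log r / (2 * T₁)) * T₁) = Real.log r := by field_simp
    rw [this, Real.exp_log hr]
  have hiter : ∀ (k : ℕ) (x : L2 𝕜 n S.a S.b),
      formL2 S.H (T (k * T₁) x) (T (k * T₁) x) ≤ r ^ k * formL2 S.H x x := by
    intro k
    induction k with
    | zero => intro x; simp [hT.zero]
    | succ k ih =>
      intro x
      have h1 : T ((k + 1 : ℕ) * T₁) x = T T₁ (T (k * T₁) x) := by
        rw [← ContinuousLinearMap.comp_apply, ← hT.add _ _ hT₁.le (by positivity)]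
        congr 2; push_cast; ring
      rw [h1, pow_succ, mul_comm (r ^ k), mul_assoc]
      exact (h _).trans (mul_le_mul_of_nonneg_left (ih x) hr.le)
  refine ⟨Real.exp (η * T₁), η, Real.exp_pos _, hη0, fun t ht x => ?_⟩
  have hfl : t / T₁ < ⌊t / T₁⌋₊ + 1 := Nat.lt_floor_add_one _
  have hfl' : (⌊t / T₁⌋₊ : ℝ) ≤ t / T₁ := Nat.floor_le (by positivity)
  set k := ⌊t / T₁⌋₊
  rw [div_lt_iff₀ hT₁] at hfl
  rw [le_div_iff₀ hT₁] at hfl'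
  have h1 := (formL2_H_semigroup_anti hS hT hA (by positivity) hfl' x).trans (hiter k x)
  have h2 : r ^ k ≤ (Real.exp (η * T₁) * Real.exp (-η * t)) ^ 2 := by
    rw [hrη, ← Real.exp_add, ← Real.exp_nat_mul, ← Real.exp_nat_mul]
    refine Real.exp_le_exp.2 ?_
    push_cast
    nlinarith
  refine (pow_le_pow_iff_left₀ (Real.sqrt_nonneg _) (mul_nonneg (by positivity)
    (Real.sqrt_nonneg _)) two_ne_zero).1 ?_
  change S.energyNorm (T t x) ^ 2 ≤ (_ * S.energyNorm x) ^ 2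
  rw [mul_pow, energyNorm_sq hS, energyNorm_sq hS]
  have h3 := mul_le_mul_of_nonneg_right h2 (formL2_H_self_nonneg hS x)
  linarith

/-- The coefficient of lower order is bounded relative to `H`, as `H` is uniformly positive. -/
theorem exists_lowerCoeff_bound (hS : S.StandingAssumptions) : ∃ κ : ℝ, 0 ≤ κ ∧
    ∀ ζ ∈ Icc S.a S.b, ∀ v : EuclideanSpace 𝕜 (Fin n),
      |formRe (S.lowerCoeff ζ) v v| ≤ κ * formRe (S.H ζ) v v := by
  obtain ⟨C, hC0, hC⟩ := (contMat_lowerCoeff hS).exists_bound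
  obtain ⟨m, M, hm, -, h⟩ := hS.formRe_H_bounds (𝕜 := 𝕜)
  refine ⟨C / m, by positivity, fun ζ hζ v => ?_⟩
  calc |formRe (S.lowerCoeff ζ) v v| ≤ C * (‖v‖ * ‖v‖) :=
        (abs_formRe_le _ _ _).trans (mul_le_mul_of_nonneg_right (hC ζ hζ) (by positivity))
    _ = C / m * (m * ‖v‖ ^ 2) := by field_simp
    _ ≤ _ := mul_le_mul_of_nonneg_left (h ζ hζ v).1 (by positivity)

theorem abs_formRe_inv_P₁_le {γ : ℝ}
    (hγH : ∀ ζ ∈ Icc S.a S.b,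
      (γ • S.H ζ - S.P₁⁻¹).PosSemidef ∧ (γ • S.H ζ + S.P₁⁻¹).PosSemidef)
    {ζ : ℝ} (hζ : ζ ∈ Icc S.a S.b) (v : EuclideanSpace 𝕜 (Fin n)) :
    |formRe S.P₁⁻¹ v v| ≤ γ * formRe (S.H ζ) v v := by
  have h1 := formRe_self_nonneg (hγH ζ hζ).1 v
  have h2 := formRe_self_nonneg (hγH ζ hζ).2 v
  rw [formRe_sub_matrix, formRe_smul_matrix] at h1
  rw [formRe_add_matrix, formRe_smul_matrix] at h2
  exact abs_le.2 ⟨by linarith, by linarith⟩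

/-- `δ` is an endpoint of `[a, b]`, and `s` the sign of the outer normal at `δ`. -/
def IsEndpoint (S : PHSystem n) (δ s : ℝ) : Prop :=
  δ = S.b ∧ s = 1 ∨ δ = S.a ∧ s = -1

theorem IsEndpoint.sq {δ s : ℝ} (h : S.IsEndpoint δ s) : s * s = 1 := by
  rcases h with ⟨-, rfl⟩ | ⟨-, rfl⟩ <;> norm_num

theorem IsEndpoint.abs_eq {δ s : ℝ} (h : S.IsEndpoint δ s) : |s| = 1 := by
  rcases h with ⟨-, rfl⟩ | ⟨-, rfl⟩ <;> norm_num

theorem IsEndpoint.mem {δ s : ℝ} (h : S.IsEndpoint δ s) (hS : S.StandingAssumptions) :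
    δ ∈ Icc S.a S.b := by
  rcases h with ⟨rfl, -⟩ | ⟨rfl, -⟩
  · exact right_mem_Icc.2 hS.lt.le
  · exact left_mem_Icc.2 hS.lt.le

theorem IsEndpoint.mul_sub_mem {δ s : ℝ} (h : S.IsEndpoint δ s) {ζ : ℝ}
    (hζ : ζ ∈ Icc S.a S.b) : -(S.b - S.a) ≤ s * (ζ - δ) ∧ s * (ζ - δ) ≤ 0 := by
  rcases h with ⟨rfl, rfl⟩ | ⟨rfl, rfl⟩ <;> constructor <;> linarith [hζ.1, hζ.2]

/-- The multiplier identity seen from an endpoint, with a weight that depends on the (negative)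
signed distance to it. -/
theorem IsEndpoint.boundary_identity {δ s : ℝ} (h : S.IsEndpoint δ s)
    (hS : S.StandingAssumptions) : ∃ δ' ∈ Icc S.a S.b, ∀ x y : L2 𝕜 n S.a S.b,
      S.opGraph 𝕜 x y → ∀ g : ℝ → ℝ, ContDiff ℝ 1 g →
        g 0 * S.energyDensityAt x δ - g (-(S.b - S.a)) * S.energyDensityAt x δ' =
          2 * formL2 (fun ζ => (s * g (s * (ζ - δ))) • S.P₁⁻¹) x y +
            formL2 (fun ζ => deriv g (s * (ζ - δ)) • S.H ζ +
              (s * g (s * (ζ - δ))) • S.lowerCoeff ζ) x x := by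
  have key : ∀ x y : L2 𝕜 n S.a S.b, S.opGraph 𝕜 x y → ∀ g : ℝ → ℝ, ContDiff ℝ 1 g →
      s * g (s * (S.b - δ)) * S.energyDensityAt x S.b -
        s * g (s * (S.a - δ)) * S.energyDensityAt x S.a =
          2 * formL2 (fun ζ => (s * g (s * (ζ - δ))) • S.P₁⁻¹) x y +
            formL2 (fun ζ => deriv g (s * (ζ - δ)) • S.H ζ +
              (s * g (s * (ζ - δ))) • S.lowerCoeff ζ) x x := by
    intro x y hxy g hg
    have hβ : ContDiff ℝ 1 fun ζ => s * g (s * (ζ - δ)) := by fun_prop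
    have hd : deriv (fun ζ => s * g (s * (ζ - δ))) = fun ζ => deriv g (s * (ζ - δ)) := by
      ext ζ
      have h1 : HasDerivAt (fun ζ => s * (ζ - δ)) (s * 1) ζ :=
        ((hasDerivAt_id ζ).sub_const δ).const_mul s
      have h2 := ((hg.differentiable (by simp) (s * (ζ - δ))).hasDerivAt.comp ζ h1).const_mul s
      rw [show s * (deriv g (s * (ζ - δ)) * (s * 1)) = s * s * deriv g (s * (ζ - δ)) by ring,
        h.sq, one_mul] at h2
      exact h2.deriv
    have h3 := PHSystem.boundary_identity hS hxy hβ
    rw [hd] at h3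
    exact h3
  rcases h with ⟨rfl, rfl⟩ | ⟨rfl, rfl⟩
  · refine ⟨S.a, left_mem_Icc.2 hS.lt.le, fun x y hxy g hg => ?_⟩
    rw [← key x y hxy g hg]
    simp
  · refine ⟨S.b, right_mem_Icc.2 hS.lt.le, fun x y hxy g hg => ?_⟩
    rw [← key x y hxy g hg]
    simp
    ring

end PHSystem

/-! ### Trace bound, observability and the equivalence -/

namespace PHSystem

variable {𝕜 : Type*} [RCLike 𝕜] {n : ℕ} {S : PHSystem n}
  {T : ℝ → L2 𝕜 n S.a S.b →L[𝕜] L2 𝕜 n S.a S.b}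

/-- Hidden regularity: the energy density at an endpoint is continuous in time along orbits in the
domain, and its time integrals are controlled by the initial energy. This uses the multiplier that
is linear in `ζ` and vanishes at the other endpoint. -/
theorem IsEndpoint.exists_trace_bound {δ s : ℝ} (hδ : S.IsEndpoint δ s)
    (hS : S.StandingAssumptions) (hT : IsC0Semigroup T) (hA : IsGenerator T (S.opGraph 𝕜))
    {γ : ℝ} (hγ : 0 < γ)
    (hγH : ∀ ζ ∈ Icc S.a S.b,
      (γ • S.H ζ - S.P₁⁻¹).PosSemidef ∧ (γ • S.H ζ + S.P₁⁻¹).PosSemidef) :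
    ∃ C : ℝ, 0 < C ∧ ∀ x ∈ S.domain 𝕜, ∀ t₀ t₁ : ℝ, 0 ≤ t₀ → t₀ ≤ t₁ →
      ContinuousOn (fun t => S.energyDensityAt (T t x) δ) (Icc t₀ t₁) ∧
      ∫ t in t₀..t₁, S.energyDensityAt (T t x) δ ≤ C * (1 + (t₁ - t₀)) * formL2 S.H x x := by
  obtain ⟨κ, hκ, hR⟩ := exists_lowerCoeff_bound (𝕜 := 𝕜) hS
  obtain ⟨δ', -, hid⟩ := hδ.boundary_identity (𝕜 := 𝕜) hS
  have hℓ : 0 < S.b - S.a := sub_pos.2 hS.lt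
  set ℓ := S.b - S.a with hℓdef
  set g : ℝ → ℝ := fun r => 1 + r / ℓ with hg
  have hgd : deriv g = fun _ => 1 / ℓ := by
    ext r
    exact (((hasDerivAt_id r).div_const ℓ).const_add 1).deriv
  have hgc : ContDiff ℝ 1 g := by fun_prop
  have hg0 : g 0 = 1 := by simp [hg]
  have hgℓ : g (-ℓ) = 0 := by simp [hg, hℓ.ne']
  have hg1 : ∀ ζ ∈ Icc S.a S.b, |s * g (s * (ζ - δ))| ≤ 1 := by
    intro ζ hζ
    obtain ⟨h1, h2⟩ := hδ.mul_sub_mem hζ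
    rw [abs_mul, hδ.abs_eq, one_mul, abs_le]
    have h3 : s * (ζ - δ) / ℓ ≤ 0 := div_nonpos_of_nonpos_of_nonneg h2 hℓ.le
    have h4 : -1 ≤ s * (ζ - δ) / ℓ := by rw [le_div_iff₀ hℓ]; linarith
    simp only [hg]
    constructor <;> linarith
  set K : ℝ → Matrix (Fin n) (Fin n) ℝ := fun ζ => (s * g (s * (ζ - δ))) • S.P₁⁻¹ with hK
  set Q : ℝ → Matrix (Fin n) (Fin n) ℝ := fun ζ => (1 / ℓ) • S.H ζ +
    (s * g (s * (ζ - δ))) • S.lowerCoeff ζ with hQ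
  have hβ : ContinuousOn (fun ζ => s * g (s * (ζ - δ))) (Icc S.a S.b) := by fun_prop
  have hKc : ContMat S.a S.b K := ContMat.smul hβ (ContMat.const _)
  have hKs : ∀ ζ ∈ Icc S.a S.b, (K ζ).IsSymm := fun ζ _ => hS.isSymm_inv_P₁.smul _
  have hQc : ContMat S.a S.b Q := (ContMat.smul (β := fun _ => 1 / ℓ) continuousOn_const
    hS.contMat_H).add (ContMat.smul hβ (contMat_lowerCoeff hS))
  have hE : ∀ x y : L2 𝕜 n S.a S.b, S.opGraph 𝕜 x y →
      S.energyDensityAt x δ = 2 * formL2 K x y + formL2 Q x x := by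
    intro x y hxy
    have := hid x y hxy g hgc
    rw [hg0, hgℓ, hgd, one_mul, zero_mul, sub_zero] at this
    exact this
  have hQle : ∀ x : L2 𝕜 n S.a S.b, formL2 Q x x ≤ (1 / ℓ + κ) * formL2 S.H x x := by
    intro x
    rw [← formL2_smul]
    refine hQc.formL2_mono (ContMat.smul (β := fun _ => 1 / ℓ + κ) continuousOn_const
      hS.contMat_H) (fun ζ hζ v => ?_) x
    simp only [hQ, formRe_add_matrix, formRe_smul_matrix]
    have h1 : s * g (s * (ζ - δ)) * formRe (S.lowerCoeff ζ) v v ≤ κ * formRe (S.H ζ) v v := by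
      refine (le_abs_self _).trans ?_
      rw [abs_mul]
      exact (mul_le_of_le_one_left (abs_nonneg _) (hg1 ζ hζ)).trans (hR ζ hζ v)
    linarith
  have hKle : ∀ x : L2 𝕜 n S.a S.b, |formL2 K x x| ≤ γ * formL2 S.H x x := by
    refine hKc.abs_formL2_le hS.contMat_H fun ζ hζ v => ?_
    simp only [hK, formRe_smul_matrix]
    rw [abs_mul]
    exact (mul_le_of_le_one_left (abs_nonneg _) (hg1 ζ hζ)).trans
      (abs_formRe_inv_P₁_le hγH hζ v)
  refine ⟨2 * γ + (1 / ℓ + κ), by positivity, fun x hx t₀ t₁ h0 h01 => ?_⟩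
  obtain ⟨y, hxy⟩ := exists_opGraph hx
  have hX := continuousOn_orbit (t₁ := t₁) hT h0 x
  have hY := continuousOn_orbit (t₁ := t₁) hT h0 y
  have hcK := (hKc.continuousOn_formL2 hX hY).const_mul 2
  have hcQ := hQc.continuousOn_formL2 hX hX
  have heq : EqOn (fun t => S.energyDensityAt (T t x) δ)
      (fun t => 2 * formL2 K (T t x) (T t y) + formL2 Q (T t x) (T t x)) (Icc t₀ t₁) :=
    fun t ht => hE _ _ (hA.map hT hxy (h0.trans ht.1))
  refine ⟨(hcK.add hcQ).congr heq, ?_⟩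
  have hFTC := intervalIntegral.integral_eq_sub_of_hasDeriv_right_of_le h01
    (hKc.continuousOn_formL2 hX hX)
    (fun r hr => hKc.hasDerivWithinAt_formL2 hKs
      (IsGenerator.hasDerivWithinAt hT hA hxy (h0.trans hr.1.le)))
    (hcK.intervalIntegrable_of_Icc h01)
  have h1 : ∫ t in t₀..t₁, S.energyDensityAt (T t x) δ =
      (formL2 K (T t₁ x) (T t₁ x) - formL2 K (T t₀ x) (T t₀ x)) +
        ∫ t in t₀..t₁, formL2 Q (T t x) (T t x) := by
    rw [← hFTC, ← intervalIntegral.integral_add (hcK.intervalIntegrable_of_Icc h01)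
      (hcQ.intervalIntegrable_of_Icc h01)]
    refine intervalIntegral.integral_congr fun t ht => heq ?_
    rwa [uIcc_of_le h01] at ht
  have hF := formL2_H_self_nonneg hS x
  have hanti : ∀ t, 0 ≤ t → formL2 S.H (T t x) (T t x) ≤ formL2 S.H x x :=
    fun t ht => formL2_H_semigroup_le hS hT hA ht x
  have h2 : ∫ t in t₀..t₁, formL2 Q (T t x) (T t x) ≤
      ∫ t in t₀..t₁, (1 / ℓ + κ) * formL2 S.H x x := by
    refine intervalIntegral.integral_mono_on h01 (hcQ.intervalIntegrable_of_Icc h01)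
      (by simp) fun t ht => ?_
    exact (hQle _).trans (mul_le_mul_of_nonneg_left (hanti t (h0.trans ht.1)) (by positivity))
  rw [intervalIntegral.integral_const, smul_eq_mul] at h2
  have h3 : formL2 K (T t₁ x) (T t₁ x) ≤ γ * formL2 S.H x x :=
    ((le_abs_self _).trans (hKle _)).trans
      (mul_le_mul_of_nonneg_left (hanti t₁ (h0.trans h01)) hγ.le)
  have h4 : -formL2 K (T t₀ x) (T t₀ x) ≤ γ * formL2 S.H x x :=
    ((neg_le_abs _).trans (hKle _)).trans (mul_le_mul_of_nonneg_left (hanti t₀ h0) hγ.le)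
  rw [h1]
  have h5 : 0 ≤ (t₁ - t₀) * (γ * formL2 S.H x x) :=
    mul_nonneg (sub_nonneg.2 h01) (mul_nonneg hγ.le hF)
  have h6 : 0 ≤ (1 / ℓ + κ) * formL2 S.H x x := mul_nonneg (by positivity) hF
  linarith

/-- Observability with a small defect. The weight `e^{μ ρ(ζ)} / cosh (lam (t - c))`, with `ρ(ζ)` the
negative distance to the endpoint `δ`, decays in space at a rate that dominates its logarithmic
derivative in time. The multiplier identity then bounds the weighted energy on a time window around
`c` by the boundary term at `δ`, up to the values of the weight at `c ± L`. -/
theorem IsEndpoint.exists_observability {δ s : ℝ} (hδ : S.IsEndpoint δ s)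
    (hS : S.StandingAssumptions) (hT : IsC0Semigroup T) (hA : IsGenerator T (S.opGraph 𝕜))
    {γ : ℝ} (hγ : 0 < γ)
    (hγH : ∀ ζ ∈ Icc S.a S.b,
      (γ • S.H ζ - S.P₁⁻¹).PosSemidef ∧ (γ • S.H ζ + S.P₁⁻¹).PosSemidef) :
    ∃ κ : ℝ, 0 ≤ κ ∧ ∀ x ∈ S.domain 𝕜, ∀ c L ε lam : ℝ, 0 ≤ c - L → 0 < ε → ε ≤ L → 0 < lam →
      2 * ε * ((Real.cosh (lam * ε))⁻¹ * Real.exp (-((κ + lam * γ + 1) * (S.b - S.a)))) *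
          formL2 S.H (T (c + L) x) (T (c + L) x) ≤
        (∫ t in (c - L)..(c + L), S.energyDensityAt (T t x) δ) +
          2 * γ * (Real.cosh (lam * L))⁻¹ * formL2 S.H x x := by
  obtain ⟨κ, hκ, hR⟩ := exists_lowerCoeff_bound (𝕜 := 𝕜) hS
  obtain ⟨δ', hδ', hid⟩ := hδ.boundary_identity (𝕜 := 𝕜) hS
  obtain ⟨_, _, htr⟩ := hδ.exists_trace_bound hS hT hA hγ hγH
  refine ⟨κ, hκ, fun x hx c L ε lam h0 hε hεL hlam => ?_⟩
  have hcL : c - L ≤ c + L := by linarith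
  set ℓ := S.b - S.a with hℓdef
  set μ := κ + lam * γ + 1 with hμ
  have hμ0 : 0 < μ := by positivity
  set g : ℝ → ℝ := fun r => Real.exp (μ * r) with hg
  have hgpos : ∀ r, 0 < g r := fun r => Real.exp_pos _
  have hgd : deriv g = fun r => μ * g r := by
    ext r
    have h1 := ((hasDerivAt_id r).const_mul μ).exp.deriv
    simp only [id, mul_one] at h1
    rw [mul_comm]
    exact h1
  have hgc : ContDiff ℝ 1 g := by fun_prop
  have hg0 : g 0 = 1 := by simp [hg]
  have hρ : ∀ ζ ∈ Icc S.a S.b, g (s * (ζ - δ)) ≤ 1 ∧ Real.exp (-(μ * ℓ)) ≤ g (s * (ζ - δ)) := by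
    intro ζ hζ
    obtain ⟨h1, h2⟩ := hδ.mul_sub_mem hζ
    refine ⟨Real.exp_le_one_iff.2 (mul_nonpos_of_nonneg_of_nonpos hμ0.le h2),
      Real.exp_le_exp.2 ?_⟩
    rw [← mul_neg]
    exact mul_le_mul_of_nonneg_left h1 hμ0.le
  set K : ℝ → Matrix (Fin n) (Fin n) ℝ := fun ζ => (s * g (s * (ζ - δ))) • S.P₁⁻¹ with hK
  set G : ℝ → Matrix (Fin n) (Fin n) ℝ := fun ζ => g (s * (ζ - δ)) • S.H ζ with hG
  set Q : ℝ → Matrix (Fin n) (Fin n) ℝ := fun ζ => (μ * g (s * (ζ - δ))) • S.H ζ +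
    (s * g (s * (ζ - δ))) • S.lowerCoeff ζ with hQ
  have hgρ : ContinuousOn (fun ζ => g (s * (ζ - δ))) (Icc S.a S.b) := by fun_prop
  have hKc : ContMat S.a S.b K := ContMat.smul (continuousOn_const.mul hgρ) (ContMat.const _)
  have hKs : ∀ ζ ∈ Icc S.a S.b, (K ζ).IsSymm := fun ζ _ => hS.isSymm_inv_P₁.smul _
  have hGc : ContMat S.a S.b G := ContMat.smul hgρ hS.contMat_H
  have hQc : ContMat S.a S.b Q := (ContMat.smul (continuousOn_const.mul hgρ) hS.contMat_H).add
    (ContMat.smul (continuousOn_const.mul hgρ) (contMat_lowerCoeff hS))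
  have hE : ∀ x y : L2 𝕜 n S.a S.b, S.opGraph 𝕜 x y →
      2 * formL2 K x y ≤ S.energyDensityAt x δ - formL2 Q x x := by
    intro x y hxy
    have h1 := hid x y hxy g hgc
    rw [hg0, hgd, one_mul] at h1
    have h2 := mul_nonneg (hgpos (-ℓ)).le (energyDensityAt_nonneg hS x hδ')
    linarith
  have hQge : ∀ x : L2 𝕜 n S.a S.b, (lam * γ + 1) * formL2 G x x ≤ formL2 Q x x := by
    intro x
    rw [← formL2_smul]
    refine ContMat.formL2_mono (ContMat.smul (β := fun _ => lam * γ + 1) continuousOn_const hGc)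
      hQc (fun ζ hζ v => ?_) x
    simp only [hQ, hG, formRe_add_matrix, formRe_smul_matrix]
    have h1 : -(s * formRe (S.lowerCoeff ζ) v v) ≤ κ * formRe (S.H ζ) v v := by
      refine (neg_le_abs _).trans ?_
      rw [abs_mul, hδ.abs_eq, one_mul]
      exact hR ζ hζ v
    have h2 := mul_le_mul_of_nonneg_left h1 (hgpos (s * (ζ - δ))).le
    rw [hμ]
    linarith
  have hKle : ∀ x : L2 𝕜 n S.a S.b, |formL2 K x x| ≤ γ * formL2 G x x := by
    refine hKc.abs_formL2_le hGc fun ζ hζ v => ?_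
    simp only [hK, hG, formRe_smul_matrix]
    rw [abs_mul, abs_mul, hδ.abs_eq, one_mul, abs_of_pos (hgpos _), mul_left_comm]
    exact mul_le_mul_of_nonneg_left (abs_formRe_inv_P₁_le hγH hζ v) (hgpos _).le
  have hGle : ∀ x : L2 𝕜 n S.a S.b, formL2 G x x ≤ formL2 S.H x x := fun x =>
    hGc.formL2_mono hS.contMat_H (fun ζ hζ v => by
      simp only [hG, formRe_smul_matrix]
      exact mul_le_of_le_one_left (hS.formRe_H_nonneg hζ v) (hρ ζ hζ).1) x
  have hGge : ∀ x : L2 𝕜 n S.a S.b, Real.exp (-(μ * ℓ)) * formL2 S.H x x ≤ formL2 G x x := by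
    intro x
    rw [← formL2_smul]
    refine ContMat.formL2_mono (ContMat.smul (β := fun _ => Real.exp (-(μ * ℓ)))
      continuousOn_const hS.contMat_H) hGc (fun ζ hζ v => ?_) x
    simp only [hG, formRe_smul_matrix]
    exact mul_le_mul_of_nonneg_right (hρ ζ hζ).2 (hS.formRe_H_nonneg hζ v)
  -- the temporal weight and its derivative
  set α : ℝ → ℝ := fun t => (Real.cosh (lam * (t - c)))⁻¹ with hα
  set α' : ℝ → ℝ := fun t =>
    -(Real.sinh (lam * (t - c)) * lam) / Real.cosh (lam * (t - c)) ^ 2 with hα'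
  have hαd : ∀ t, HasDerivAt α (α' t) t := by
    intro t
    have h1 : HasDerivAt (fun t => lam * (t - c)) lam t := by
      simpa using ((hasDerivAt_id t).sub_const c).const_mul lam
    exact h1.cosh.inv (Real.cosh_pos _).ne'
  have hαpos : ∀ t, 0 < α t := fun t => inv_pos.2 (Real.cosh_pos _)
  have hα1 : ∀ t, α t ≤ 1 := fun t => inv_le_one_of_one_le₀ (Real.one_le_cosh _)
  have hαle : ∀ t, |α' t| ≤ lam * α t := by
    intro t
    have hc := Real.cosh_pos (lam * (t - c))
    have h1 : |Real.sinh (lam * (t - c))| ≤ Real.cosh (lam * (t - c)) := by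
      refine abs_le_of_sq_le_sq ?_ hc.le
      rw [Real.cosh_sq]
      linarith
    simp only [hα', hα]
    rw [abs_div, abs_neg, abs_mul, abs_of_pos hlam, abs_of_pos (pow_pos hc 2),
      div_le_iff₀ (pow_pos hc 2)]
    have h2 : lam * (Real.cosh (lam * (t - c)))⁻¹ * Real.cosh (lam * (t - c)) ^ 2 =
        lam * Real.cosh (lam * (t - c)) := by field_simp
    rw [h2, mul_comm]
    exact mul_le_mul_of_nonneg_left h1 hlam.le
  have hαc : Continuous α := continuous_iff_continuousAt.2 fun t => (hαd t).continuousAt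
  have hα'c : Continuous α' := by
    refine Continuous.div ?_ ?_ fun t => (pow_pos (Real.cosh_pos _) 2).ne'
    · fun_prop
    · fun_prop
  obtain ⟨y, hxy⟩ := exists_opGraph hx
  have hX := continuousOn_orbit (t₁ := c + L) hT h0 x
  have hY := continuousOn_orbit (t₁ := c + L) hT h0 y
  have hcV := hKc.continuousOn_formL2 hX hX
  have hcV' := (hKc.continuousOn_formL2 hX hY).const_mul 2
  have hcG := hGc.continuousOn_formL2 hX hX
  have hcE := (htr x hx _ _ h0 hcL).1
  have hcD : ContinuousOn (fun t => α' t * formL2 K (T t x) (T t x) +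
      α t * (2 * formL2 K (T t x) (T t y))) (Icc (c - L) (c + L)) :=
    (hα'c.continuousOn.mul hcV).add (hαc.continuousOn.mul hcV')
  have hcN : ContinuousOn (fun t => α t * formL2 G (T t x) (T t x)) (Icc (c - L) (c + L)) :=
    hαc.continuousOn.mul hcG
  have hFTC := intervalIntegral.integral_eq_sub_of_hasDeriv_right_of_le hcL
    (hαc.continuousOn.mul hcV)
    (fun r hr => (hαd r).hasDerivWithinAt.mul (hKc.hasDerivWithinAt_formL2 hKs
      (IsGenerator.hasDerivWithinAt hT hA hxy (h0.trans hr.1.le))))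
    (hcD.intervalIntegrable_of_Icc hcL)
  -- the choice of `μ` leaves exactly `-α` times the weighted energy
  have hpt : ∀ t ∈ Icc (c - L) (c + L), α' t * formL2 K (T t x) (T t x) +
      α t * (2 * formL2 K (T t x) (T t y)) ≤
        S.energyDensityAt (T t x) δ - α t * formL2 G (T t x) (T t x) := by
    intro t ht
    have ht0 : 0 ≤ t := h0.trans ht.1
    have h1 := hE _ _ (hA.map hT hxy ht0)
    have h2 := hQge (T t x)
    have h3 : α' t * formL2 K (T t x) (T t x) ≤ lam * α t * (γ * formL2 G (T t x) (T t x)) := by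
      refine (le_abs_self _).trans ?_
      rw [abs_mul]
      exact mul_le_mul (hαle t) (hKle _) (abs_nonneg _) (mul_pos hlam (hαpos t)).le
    have h4 : α t * (2 * formL2 K (T t x) (T t y)) ≤ α t * (S.energyDensityAt (T t x) δ -
        (lam * γ + 1) * formL2 G (T t x) (T t x)) :=
      mul_le_mul_of_nonneg_left (by linarith) (hαpos t).le
    have h5 : α t * S.energyDensityAt (T t x) δ ≤ S.energyDensityAt (T t x) δ :=
      mul_le_of_le_one_left (energyDensityAt_nonneg hS _ (hδ.mem hS)) (hα1 t)
    linarith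
  have hint := intervalIntegral.integral_mono_on hcL (hcD.intervalIntegrable_of_Icc hcL)
    (ContinuousOn.intervalIntegrable_of_Icc (μ := volume) hcL (hcE.fun_sub hcN)) hpt
  rw [hFTC, intervalIntegral.integral_sub (hcE.intervalIntegrable_of_Icc hcL)
    (hcN.intervalIntegrable_of_Icc hcL)] at hint
  -- the values of the weight at the ends of the time interval
  have hends : α (c + L) = (Real.cosh (lam * L))⁻¹ ∧ α (c - L) = (Real.cosh (lam * L))⁻¹ := by
    simp only [hα]
    constructor
    · rw [add_sub_cancel_left]
    · rw [sub_sub_cancel_left, mul_neg, Real.cosh_neg]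
  have hV : ∀ t, 0 ≤ t → |formL2 K (T t x) (T t x)| ≤ γ * formL2 S.H x x := fun t ht =>
    (hKle _).trans (mul_le_mul_of_nonneg_left
      ((hGle _).trans (formL2_H_semigroup_le hS hT hA ht x)) hγ.le)
  have hA1 : -(α (c + L) * formL2 K (T (c + L) x) (T (c + L) x)) ≤
      (Real.cosh (lam * L))⁻¹ * (γ * formL2 S.H x x) := by
    rw [hends.1, ← mul_neg]
    exact mul_le_mul_of_nonneg_left ((neg_le_abs _).trans (hV _ (h0.trans hcL)))
      (inv_pos.2 (Real.cosh_pos _)).le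
  have hA2 : α (c - L) * formL2 K (T (c - L) x) (T (c - L) x) ≤
      (Real.cosh (lam * L))⁻¹ * (γ * formL2 S.H x x) := by
    rw [hends.2]
    exact mul_le_mul_of_nonneg_left ((le_abs_self _).trans (hV _ h0))
      (inv_pos.2 (Real.cosh_pos _)).le
  have hGnn : ∀ z : L2 𝕜 n S.a S.b, 0 ≤ formL2 G z z := fun z =>
    (mul_nonneg (Real.exp_pos _).le (formL2_H_self_nonneg hS z)).trans (hGge z)
  -- lower bound on the window `[c - ε, c + ε]`
  have hsub : Icc (c - ε) (c + ε) ⊆ Icc (c - L) (c + L) :=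
    Icc_subset_Icc (by linarith) (by linarith)
  have hB1 : ∫ t in (c - ε)..(c + ε), α t * formL2 G (T t x) (T t x) ≤
      ∫ t in (c - L)..(c + L), α t * formL2 G (T t x) (T t x) := by
    refine intervalIntegral.integral_mono_interval (by linarith) (by linarith) (by linarith)
      (ae_of_all _ fun t => mul_nonneg (hαpos t).le (hGnn _)) (hcN.intervalIntegrable_of_Icc hcL)
  have hB2 : ∫ _ in (c - ε)..(c + ε), (Real.cosh (lam * ε))⁻¹ * (Real.exp (-(μ * ℓ)) *
      formL2 S.H (T (c + L) x) (T (c + L) x)) ≤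
      ∫ t in (c - ε)..(c + ε), α t * formL2 G (T t x) (T t x) := by
    refine intervalIntegral.integral_mono_on (by linarith) (by simp)
      ((hcN.mono hsub).intervalIntegrable_of_Icc (by linarith)) fun t ht => ?_
    have h1 : (Real.cosh (lam * ε))⁻¹ ≤ α t := by
      refine inv_anti₀ (Real.cosh_pos _) (Real.cosh_le_cosh.2 ?_)
      rw [abs_mul, abs_mul]
      refine mul_le_mul_of_nonneg_left ?_ (abs_nonneg _)
      rw [abs_of_pos hε, abs_le]
      constructor <;> linarith [ht.1, ht.2]
    have h2 := formL2_H_semigroup_anti hS hT hA (h0.trans (hsub ht).1) (hsub ht).2 x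
    have h3 := (mul_le_mul_of_nonneg_left h2 (Real.exp_pos (-(μ * ℓ))).le).trans (hGge (T t x))
    exact mul_le_mul h1 h3 (mul_nonneg (Real.exp_pos _).le (formL2_H_self_nonneg hS _))
      (hαpos t).le
  rw [intervalIntegral.integral_const, smul_eq_mul] at hB2
  simp only [Pi.mul_apply] at hint
  linarith

/-- If the time window is longer than `2 γ (b - a)`, the defect in the observability estimate can be
made smaller than the observed energy. -/
theorem exists_defect_lt {γ κ ℓ L : ℝ} (hγ : 0 < γ) (hL : γ * ℓ < L) (hℓ : 0 ≤ γ * ℓ) :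
    ∃ ε lam : ℝ, 0 < ε ∧ ε ≤ L ∧ 0 < lam ∧ 2 * γ * (Real.cosh (lam * L))⁻¹ <
      2 * ε * ((Real.cosh (lam * ε))⁻¹ * Real.exp (-((κ + lam * γ + 1) * ℓ))) := by
  -- with this `ε`, the quotient of the two sides decays like `e^{-lam ε}`
  set ε := (L - γ * ℓ) / 2 with hε
  have hε0 : 0 < ε := by rw [hε]; linarith
  have hlim : Tendsto (fun lam : ℝ => Real.exp (ε * lam)) atTop atTop :=
    Real.tendsto_exp_atTop.comp (tendsto_id.const_mul_atTop hε0)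
  obtain ⟨lam, hlam, hlam0⟩ := ((hlim.eventually_gt_atTop
    (2 * γ / (ε * Real.exp (-((κ + 1) * ℓ))))).and (eventually_gt_atTop 0)).exists
  refine ⟨ε, lam, hε0, by rw [hε]; linarith, hlam0, ?_⟩
  rw [div_lt_iff₀ (by positivity)] at hlam
  have h1 : (Real.cosh (lam * L))⁻¹ ≤ 2 * Real.exp (-(lam * L)) := by
    rw [Real.exp_neg, ← div_eq_mul_inv, inv_le_comm₀ (Real.cosh_pos _) (by positivity), inv_div,
      Real.cosh_eq]
    linarith [Real.exp_pos (-(lam * L))]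
  have h2 : Real.exp (-(lam * ε)) ≤ (Real.cosh (lam * ε))⁻¹ := by
    rw [Real.exp_neg]
    refine inv_anti₀ (Real.cosh_pos _) ?_
    rw [Real.cosh_eq]
    have : Real.exp (-(lam * ε)) ≤ Real.exp (lam * ε) :=
      Real.exp_le_exp.2 (by linarith [mul_pos hlam0 hε0])
    linarith
  have h3 : Real.exp (ε * lam) * Real.exp (-((κ + 1) * ℓ)) * Real.exp (-(lam * L)) =
      Real.exp (-(lam * ε)) * Real.exp (-((κ + lam * γ + 1) * ℓ)) := by
    rw [← Real.exp_add, ← Real.exp_add, ← Real.exp_add]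
    congr 1
    have hL' : L = 2 * ε + γ * ℓ := by rw [hε]; ring
    rw [hL']
    ring
  calc 2 * γ * (Real.cosh (lam * L))⁻¹ ≤ 2 * γ * (2 * Real.exp (-(lam * L))) := by gcongr
    _ = 2 * (2 * γ * Real.exp (-(lam * L))) := by ring
    _ < 2 * (Real.exp (ε * lam) * (ε * Real.exp (-((κ + 1) * ℓ))) * Real.exp (-(lam * L))) := by
        gcongr
    _ = 2 * ε * (Real.exp (-(lam * ε)) * Real.exp (-((κ + lam * γ + 1) * ℓ))) := by
        rw [← h3]; ring
    _ ≤ _ := by gcongr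

/-- At a late time `T₁` at least three quarters of the initial energy are lost, which dominates the
trace bound. -/
theorem IsEndpoint.dissipationAt_of_exponentiallyStable {δ s : ℝ} (hδ : S.IsEndpoint δ s)
    (hS : S.StandingAssumptions) (hT : IsC0Semigroup T) (hA : IsGenerator T (S.opGraph 𝕜))
    {γ : ℝ} (hγ : 0 < γ)
    (hγH : ∀ ζ ∈ Icc S.a S.b,
      (γ • S.H ζ - S.P₁⁻¹).PosSemidef ∧ (γ • S.H ζ + S.P₁⁻¹).PosSemidef)
    (h : S.ExponentiallyStable T) : S.DissipationAt γ T δ := by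
  obtain ⟨C, r, hC, hr, hstab⟩ := h
  obtain ⟨D, hD, htr⟩ := hδ.exists_trace_bound hS hT hA hγ hγH
  have hℓ : 0 < S.b - S.a := sub_pos.2 hS.lt
  -- any window longer than `2 γ (b - a)` will do; only `T₁` has to be late
  set τ := 2 + 2 * γ * (S.b - S.a) with hτ
  have hτ1 : 1 < τ := by
    have : 0 < 2 * γ * (S.b - S.a) := by positivity
    linarith
  have hlim : Tendsto (fun t : ℝ => C * Real.exp (-r * t)) atTop (𝓝 0) := by
    have h1 : Tendsto (fun t : ℝ => -r * t) atTop atBot :=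
      tendsto_id.const_mul_atTop_of_neg (neg_lt_zero.2 hr)
    simpa using (Real.tendsto_exp_atBot.comp h1).const_mul C
  obtain ⟨T₁, hT₁, hT₁τ⟩ := ((hlim.eventually_lt_const (by norm_num : (0 : ℝ) < 1 / 2)).and
    (eventually_gt_atTop τ)).exists
  refine ⟨1, τ, T₁, 1 / (4 * D * (1 + (τ - 1))), one_pos, hτ1, hT₁τ, by linarith,
    by positivity, fun x hx => ?_⟩
  have h1 := hstab T₁ (by linarith) x
  have hn : ∀ z : L2 𝕜 n S.a S.b, 0 ≤ S.energyNorm z := fun z => Real.sqrt_nonneg _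
  have h2 : S.energyNorm (T T₁ x) ≤ 1 / 2 * S.energyNorm x :=
    h1.trans (mul_le_mul_of_nonneg_right hT₁.le (hn x))
  have h3 : S.energyNorm (T T₁ x) ^ 2 ≤ (1 / 2 * S.energyNorm x) ^ 2 :=
    pow_le_pow_left₀ (hn _) h2 2
  have h4 := (htr x hx 1 τ zero_le_one hτ1.le).2
  have h5 : 1 / (4 * D * (1 + (τ - 1))) * ∫ t in (1 : ℝ)..τ, S.energyDensityAt (T t x) δ ≤
      1 / 4 * formL2 S.H x x := by
    have hpos : 0 < 4 * D * (1 + (τ - 1)) := by positivity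
    rw [div_mul_eq_mul_div, one_mul, div_le_iff₀ hpos]
    linarith
  have h6 := energyNorm_sq hS x
  have h7 := formL2_H_self_nonneg hS x
  rw [mul_pow] at h3
  linarith

/-- The dissipation inequality and the observability estimate give
`(1 + 2 k q₁) E(T₁) ≤ (1 + 2 k q₂) E(0)` with `q₂ < q₁`. -/
theorem IsEndpoint.exponentiallyStable_of_dissipationAt {δ s : ℝ} (hδ : S.IsEndpoint δ s)
    (hS : S.StandingAssumptions) (hT : IsC0Semigroup T) (hA : IsGenerator T (S.opGraph 𝕜))
    {γ : ℝ} (hγ : 0 < γ)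
    (hγH : ∀ ζ ∈ Icc S.a S.b,
      (γ • S.H ζ - S.P₁⁻¹).PosSemidef ∧ (γ • S.H ζ + S.P₁⁻¹).PosSemidef)
    (h : S.DissipationAt γ T δ) : S.ExponentiallyStable T := by
  obtain ⟨σ, τ, T₁, k, hσ, hστ, hτT, hlen, hk, hdiss⟩ := h
  obtain ⟨κ, hκ, hobs⟩ := hδ.exists_observability hS hT hA hγ hγH
  have hℓ : 0 < S.b - S.a := sub_pos.2 hS.lt
  obtain ⟨ε, lam, hε, hεL, hlam, hq⟩ := exists_defect_lt (κ := κ) (γ := γ) (ℓ := S.b - S.a)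
    (L := (τ - σ) / 2) hγ (by linarith) (by positivity)
  have hq2 : 0 ≤ 2 * γ * (Real.cosh (lam * ((τ - σ) / 2)))⁻¹ :=
    mul_nonneg (by positivity) (inv_pos.2 (Real.cosh_pos _)).le
  set q₁ := 2 * ε * ((Real.cosh (lam * ε))⁻¹ * Real.exp (-((κ + lam * γ + 1) * (S.b - S.a))))
  set q₂ := 2 * γ * (Real.cosh (lam * ((τ - σ) / 2)))⁻¹
  -- the energy is half of `formL2 S.H`, hence the factors `2`
  have hden : 0 < 1 + 2 * k * q₁ := by
    have := mul_pos hk (hq2.trans_lt hq)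
    linarith
  have hnum : 0 < 1 + 2 * k * q₂ := by
    have := mul_nonneg hk.le hq2
    linarith
  refine exponentiallyStable_of_strict_contraction hS hT hA (T₁ := T₁)
    (r := (1 + 2 * k * q₂) / (1 + 2 * k * q₁)) (by linarith) (div_pos hnum hden) ?_ ?_
  · rw [div_lt_one hden]
    have := mul_lt_mul_of_pos_left hq hk
    linarith
  intro x
  have hclosed : IsClosed {x : L2 𝕜 n S.a S.b | formL2 S.H (T T₁ x) (T T₁ x) ≤
      (1 + 2 * k * q₂) / (1 + 2 * k * q₁) * formL2 S.H x x} :=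
    isClosed_le (continuous_formL2_H hS (T T₁))
      ((continuous_formL2_H hS (ContinuousLinearMap.id 𝕜 _)).const_mul _)
  refine hclosed.closure_subset_iff.2 ?_ (IsGenerator.dense_domain hT hA x)
  rintro x ⟨y, hxy⟩
  change formL2 S.H (T T₁ x) (T T₁ x) ≤ _ * formL2 S.H x x
  have h1 := hobs x hxy.1 ((σ + τ) / 2) ((τ - σ) / 2) ε lam (by linarith) hε hεL hlam
  rw [show (σ + τ) / 2 - (τ - σ) / 2 = σ by ring,
    show (σ + τ) / 2 + (τ - σ) / 2 = τ by ring] at h1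
  have h2 := hdiss x hxy.1
  rw [energyNorm_sq hS, energyNorm_sq hS] at h2
  have h3 := formL2_H_semigroup_anti hS hT hA (hσ.le.trans hστ.le) hτT.le x
  have h4 := mul_le_mul_of_nonneg_left
    ((mul_le_mul_of_nonneg_left h3 (hq2.trans hq.le)).trans h1) hk.le
  rw [div_mul_eq_mul_div, le_div_iff₀ hden]
  linarith

end PHSystem

end PortHamiltonian

theorem mainTheorem1 {𝕜 : Type*} [RCLike 𝕜] {n : ℕ}
    (S : PortHamiltonian.PHSystem n) (hS : S.StandingAssumptions)
    (T : ℝ → PortHamiltonian.L2 𝕜 n S.a S.b →L[𝕜] PortHamiltonian.L2 𝕜 n S.a S.b)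
    (hT : PortHamiltonian.IsC0Semigroup T)
    (hA : PortHamiltonian.IsGenerator T (S.opGraph 𝕜))
    (γ : ℝ) (hγ : 0 < γ)
    (hγH : ∀ ζ ∈ Set.Icc S.a S.b,
      (γ • S.H ζ - S.P₁⁻¹).PosSemidef ∧ (γ • S.H ζ + S.P₁⁻¹).PosSemidef) :
    List.TFAE
      [S.ExponentiallyStable T,
       S.DissipationAt γ T S.b,
       S.DissipationAt γ T S.a] := by
  have hb : S.IsEndpoint S.b 1 := Or.inl ⟨rfl, rfl⟩
  have ha : S.IsEndpoint S.a (-1) := Or.inr ⟨rfl, rfl⟩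
  tfae_have 1 → 2 := hb.dissipationAt_of_exponentiallyStable hS hT hA hγ hγH
  tfae_have 2 → 1 := hb.exponentiallyStable_of_dissipationAt hS hT hA hγ hγH
  tfae_have 1 → 3 := ha.dissipationAt_of_exponentiallyStable hS hT hA hγ hγH
  tfae_have 3 → 1 := ha.exponentiallyStable_of_dissipationAt hS hT hA hγ hγH
  tfae_finish
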